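/- Let $j\ge 1$ be an integer and let $I,J,P,Q$ range over a finite index set; repeated indices are summed. **The potential.** For complex numbers $x=(x^I_m)$, $-j\le m\le j$, put $x^I_{NS}(\zeta)=\sum_{m=-j}^{j}x^I_m\zeta^{-m}$ and $$L(x)=\oint_{\mathcal C}\frac{d\zeta}{2\pi i\,\zeta}\,H(x_{NS}(\zeta),\zeta),$$ where $H$ is a (possibly multi-valued) holomorphic function and $\mathcal C$ is a contour in $\mathbb C\setminus\{0\}$, made of finitely many $C^1$ arcs along each of which a holomorphic branch of $H$ is used; the contour is fixed locally in $x$. Derivatives $L_{x^I_m}$, $L_{x^I_mx^J_{m'}}$ are taken with the $x^I_m$ as independent complex variables. Assume that $L$ is real on the points satisfying the reality condition $(-1)^m\overline{x^I_{-m}}=x^I_m$. **The construction.** Let $U$ be an open set in the space with complex coordinates $(z^I,u_I)$, and let $x^I_m$ ($-j\le m\le j$; real-differentiable) and $p_{I,m}$ ($m\in\mathbb Z$, $p_{I,m}=0$ for $m>1-j$) be functions on $U$ with $x^I_j=z^I$, $p_{I,1-j}=u_I$, and, for $-j\le m\le j$, $$(-1)^m\overline{x^I_{-m}}=x^I_m,\qquad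 (-1)^m\overline{p_{I,-m}}=p_{I,m}-i\,L_{x^I_{-m}} .$$ (Thus $L_{x^I_j}=-ip_{I,-j}$; moreover $L_{x^I_0}=2\,\mathrm{Im}\,u_I$ if $j=1$, while $L_{x^I_{j-1}}=-iu_I$ and $L_{x^I_m}=0$ for $|m|\le j-2$ if $j\ge2$.) Let $\omega_+$ and $\omega_3$ be the coefficients of $\zeta^0$ and $\zeta^1$ in $dp_{I,N}(\zeta)\wedge dx^I_N(\zeta)$, where $x^I_N(\zeta)=\sum_n x^I_n\zeta^{j-n}$ and $p_{I,N}(\zeta)=\sum_{n\le 1-j}p_{I,n}\zeta^{1-j-n}$, that is, $$\omega_+=dp_{I,1-j}\wedge dx^I_j,\qquad \omega_3=dp_{I,-j}\wedge dx^I_j+dp_{I,1-j}\wedge dx^I_{j-1},$$ and let $\omega_1,\omega_2$ be the real forms with $\omega_+=\frac12(\omega_1+i\omega_2)$. Products of 1-forms are normalized by $\alpha\beta=\frac12(\alpha\otimes\beta+\beta\otimes\alpha)$, $\alpha\wedge\beta=\frac12(\alpha\otimes\beta-\beta\otimes\alpha)$. **The matrices.** Let $a,b$ range over the variables $x^I_m$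 with $1-j\le m\le j-1$, and let $(L^{ab})$ be the inverse of the matrix $(L_{ab})$. Let $\Phi^{I\bar J}=L^{x^I_{j-1}x^J_{1-j}}$, let $(\Phi_{\bar JI})$ be the inverse matrix of $(\Phi^{I\bar J})$, let $\Phi_{I\bar J}=\overline{\Phi_{\bar IJ}}$, and let $$A_{IJ}=-i\,L_{x^I_ja}\,L^{a\,x^P_{1-j}}\,\Phi_{\bar PJ},\qquad \bar A_{\bar J\bar I}=\overline{A_{IJ}} .$$ **Proposition.** At every point of $U$ at which the matrices $(L_{ab})$ and $(\Phi^{I\bar J})$ are invertible, the following hold. The matrix $\Phi^{I\bar J}$ is Hermitian and $\bar A_{\bar J\bar I}=-i\,\Phi_{\bar JP}L^{x^P_{j-1}a}L_{a\,x^I_{-j}}$. The form $\omega_3$ is real, $$\omega_+=du_I\wedge dz^I,$$ $$\omega_3=(-1)^{j-1}i\,\big[\Phi_{I\bar J}\,dz^I\wedge d\bar z^{J}+\Phi^{I\bar J}(du_I+dz^PA_{PI})\wedge(d\bar u_{J}+\bar A_{\bar J\bar Q}\,d\bar z^{Q})\big],$$ and $\omega_3=-i\,\partial\bar\partial\kappa$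 for $\kappa=L+iu_Ix^I_{j-1}-i\bar u_I\overline{x^I_{j-1}}$. The forms $\omega_1,\omega_2,\omega_3$ are nondegenerate; the endomorphisms $I_1=\omega_3^{-1}\omega_2$, $I_2=\omega_1^{-1}\omega_3$, $I_3=\omega_2^{-1}\omega_1$ satisfy $I_1^2=I_2^2=I_3^2=-1$ and $I_1I_2=I_3$; $I_3$ is the complex structure of the coordinates $(z^I,u_I)$; and the hyperkähler metric $g(X,Y)=-\omega_1(X,I_1Y)=-\omega_2(X,I_2Y)=-\omega_3(X,I_3Y)$ is $$ds^2=(-1)^j\big[\,dz^I\,\Phi_{I\bar J}\,d\bar z^{J}+(du_I+dz^PA_{PI})\,\Phi^{I\bar J}\,(d\bar u_{J}+\bar A_{\bar J\bar Q}\,d\bar z^{Q})\big].$$ -/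

import Mathlib

open scoped ComplexConjugate Topology

noncomputable section

namespace GLT

/-! ### Coefficients of `O(2j)` sections -/

/-- The range `m = -j, …, j` of the coefficients `x^I_m`. -/
abbrev Idx (j : ℕ) : Type := ↥(Finset.Icc (-(j : ℤ)) (j : ℤ))

/-- The range `m = 1-j, …, j-1` of the indices `a`, `b`. -/
abbrev Inner (j : ℕ) : Type := ↥(Finset.Icc (1 - (j : ℤ)) ((j : ℤ) - 1))

/-- The space of coefficients `(x^I_m)`, regarded as independent complex variables. -/
abbrev Coeff (ι : Type*) (j : ℕ) : Type _ := ι × Idx j → ℂ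

/-- The space with complex coordinates `(z^I, u_I)`. -/
abbrev Hol (ι : Type*) : Type _ := (ι → ℂ) × (ι → ℂ)

/-- The coefficient `x^I_m`, which is zero for `m` outside `-j, …, j`. -/
def coef {ι : Type*} {j : ℕ} (x : Coeff ι j) (I : ι) (m : ℤ) : ℂ :=
  if h : m ∈ Finset.Icc (-(j : ℤ)) (j : ℤ) then x (I, ⟨m, h⟩) else 0

/-- The reality condition `(-1)^m conj (x^I_{-m}) = x^I_m`. -/
def IsRealCoeff {ι : Type*} {j : ℕ} (x : Coeff ι j) : Prop :=
  ∀ (I : ι) (m : ℤ), (-1 : ℂ) ^ m * conj (coef x I (-m)) = coef x I m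

/-- The tropical component `x^I_{NS}(ζ) = ∑_n x^I_n ζ^{-n}` (equal to `ζ^{-j} x^I_N(ζ)`). -/
def tropical {ι : Type*} {j : ℕ} (x : Coeff ι j) (ζ : ℂ) : ι → ℂ :=
  fun I => ∑ n : Idx j, x (I, n) * ζ ^ (-(n : ℤ))

/-! ### The contour-integral potential -/

/-- A single-valued holomorphic function `H(y, ζ)` on an open set. A multi-valued holomorphic
function (or a sum of several) is presented by the family of its single-valued branches. -/
structure FunctionElement (ι : Type*) [Fintype ι] where
  dom : Set ((ι → ℂ) × ℂ)
  isOpen_dom : IsOpen dom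
  toFun : (ι → ℂ) × ℂ → ℂ
  analytic : AnalyticOnNhd ℂ toFun dom

/-- A `C¹` arc in the punctured `ζ`-plane, parametrized by `[0, 1]`, together with the branch
of `H` to be used along it. -/
structure Arc (B : Type*) where
  branch : B
  path : ℝ → ℂ
  contDiff : ContDiff ℝ 1 path
  ne_zero : ∀ t ∈ Set.Icc (0 : ℝ) 1, path t ≠ 0

/-- A contour, cut into finitely many arcs. A closed contour on the Riemann surface of a
multi-valued `H` is of this form, and so is a finite union of such contours for the different
terms of `H`; that the arcs close up is not needed. -/
abbrev Contour (B : Type*) := List (Arc B)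

/-- The graph `{(x_{NS}(ζ), ζ) : ζ ∈ C}` lies where the chosen branches are holomorphic. -/
def Contour.Admissible {ι B : Type*} [Fintype ι] {j : ℕ} (H : B → FunctionElement ι)
    (C : Contour B) (x : Coeff ι j) : Prop :=
  ∀ γ ∈ C, ∀ t ∈ Set.Icc (0 : ℝ) 1,
    (tropical x (γ.path t), γ.path t) ∈ (H γ.branch).dom

/-- The contour integral `∮_C dζ / (2πiζ) H(x_{NS}(ζ), ζ)`. -/
def Contour.potential {ι B : Type*} [Fintype ι] {j : ℕ} (H : B → FunctionElement ι)
    (C : Contour B) (x : Coeff ι j) : ℂ :=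
  (C.map fun γ => ∫ t in (0 : ℝ)..1,
    deriv γ.path t / (2 * (Real.pi : ℂ) * Complex.I * γ.path t) *
      (H γ.branch).toFun (tropical x (γ.path t), γ.path t)).sum

/-- Near `x₀` the function `L` is the integral of `H` over a contour, which is kept fixed near
`x₀` but may have to be deformed when `x₀` moves over longer distances. -/
def IsContourPotentialAt {ι B : Type*} [Fintype ι] {j : ℕ} (H : B → FunctionElement ι)
    (L : Coeff ι j → ℂ) (x₀ : Coeff ι j) : Prop :=
  ∃ C : Contour B, C.Admissible H x₀ ∧ ∀ᶠ x in 𝓝 x₀, L x = C.potential H x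

/-- The coordinate direction of `x^I_m`. -/
def dir {ι : Type*} [DecidableEq ι] {j : ℕ} (I : ι) (m : ℤ) : Coeff ι j :=
  fun k => if k.1 = I ∧ (k.2 : ℤ) = m then 1 else 0

/-- The first derivative `L_{x^I_m}`, the `x^I_m` being independent complex variables. -/
def d1 {ι : Type*} [Fintype ι] [DecidableEq ι] {j : ℕ} (L : Coeff ι j → ℂ)
    (I : ι) (m : ℤ) (x : Coeff ι j) : ℂ :=
  fderiv ℂ L x (dir I m)

/-- The second derivative `L_{x^I_m x^J_n}`. -/
def d2 {ι : Type*} [Fintype ι] [DecidableEq ι] {j : ℕ} (L : Coeff ι j → ℂ)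
    (I : ι) (m : ℤ) (J : ι) (n : ℤ) (x : Coeff ι j) : ℂ :=
  fderiv ℂ (fun y => d1 L J n y) x (dir I m)

/-! ### The equations of the construction -/

/-- The functions `x^I_m` and `p_{I,m}` of the coordinates `(z, u)` satisfy the equations of the
(generalized) Legendre transform construction. Here `p_{I,m}` is the coefficient of `ζ^{1-j-m}` in
the power series `p_{I,N}(ζ)`, whence it vanishes for `m > 1 - j`. For `j = 1` the equations
`matching` say that `L_{x^I_0} = 2 Im u_I` and `L_{x^I_1} = -i p_{I,-1}`; for `j ≥ 2` they say that
`L_{x^I_{j-1}} = -i u_I`, that `L_{x^I_m} = 0` for `|m| ≤ j - 2`, and that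
`L_{x^I_j} = -i p_{I,-j}`; the others are the complex conjugates of these. -/
structure IsGLTSolution {ι : Type*} [Fintype ι] [DecidableEq ι] {j : ℕ} (L : Coeff ι j → ℂ)
    (U : Set (Hol ι)) (x : Hol ι → Coeff ι j) (p : ι → ℤ → Hol ι → ℂ) : Prop where
  real : ∀ q ∈ U, IsRealCoeff (x q)
  leading_x : ∀ q ∈ U, ∀ I, coef (x q) I (j : ℤ) = q.1 I
  leading_p : ∀ q ∈ U, ∀ I, p I (1 - (j : ℤ)) q = q.2 I
  p_eq_zero : ∀ q ∈ U, ∀ I, ∀ m : ℤ, 1 - (j : ℤ) < m → p I m q = 0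
  matching : ∀ q ∈ U, ∀ I, ∀ m ∈ Finset.Icc (-(j : ℤ)) (j : ℤ),
    (-1 : ℂ) ^ m * conj (p I (-m) q) = p I m q - Complex.I * d1 L I (-m) (x q)

/-! ### Forms on the coordinate domain

The symmetric and the exterior product of 1-forms are normalized alike,
`αβ = (α ⊗ β + β ⊗ α)/2` and `α ∧ β = (α ⊗ β - β ⊗ α)/2`, so that a line element
`ds² = ∑ g_{ab} dx^a dx^b` takes the value `∑ g_{ab} dx^a(X) dx^b(X)` on a vector `X`. -/

def symProd {ι : Type*} [Fintype ι] (α β : Hol ι →L[ℝ] ℂ) (X Y : Hol ι) : ℂ :=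
  (α X * β Y + α Y * β X) / 2

def wedge {ι : Type*} [Fintype ι] (α β : Hol ι →L[ℝ] ℂ) (X Y : Hol ι) : ℂ :=
  (α X * β Y - α Y * β X) / 2

/-- The complex conjugate of a complex-valued 1-form. -/
def conjForm {ι : Type*} [Fintype ι] (α : Hol ι →L[ℝ] ℂ) : Hol ι →L[ℝ] ℂ :=
  (Complex.conjCLE : ℂ →L[ℝ] ℂ).comp α

/-- The 1-form `dz^I`. -/
def dz {ι : Type*} [Fintype ι] (I : ι) : Hol ι →L[ℝ] ℂ :=
  (ContinuousLinearMap.proj I).comp (ContinuousLinearMap.fst ℝ (ι → ℂ) (ι → ℂ))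

/-- The 1-form `du_I`. -/
def du {ι : Type*} [Fintype ι] (I : ι) : Hol ι →L[ℝ] ℂ :=
  (ContinuousLinearMap.proj I).comp (ContinuousLinearMap.snd ℝ (ι → ℂ) (ι → ℂ))

/-- The coefficient of `ζ^k` in `ω_N(ζ) = ∑_I dp_{I,N}(ζ) ∧ dx^I_N(ζ)`, where
`p_{I,N}(ζ) = ∑_{n ≤ 1-j} p_{I,n} ζ^{1-j-n}` and `x^I_N(ζ) = ∑_n x^I_n ζ^{j-n}`. -/
def omegaN {ι : Type*} [Fintype ι] {j : ℕ} (x : Hol ι → Coeff ι j)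
    (p : ι → ℤ → Hol ι → ℂ) (k : ℕ) (q : Hol ι) (X Y : Hol ι) : ℂ :=
  ∑ I, ∑ s ∈ Finset.range (k + 1),
    wedge (fderiv ℝ (fun r => p I (1 - (j : ℤ) - (s : ℤ)) r) q)
      (fderiv ℝ (fun r => coef (x r) I ((j : ℤ) - ((k : ℤ) - (s : ℤ)))) q) X Y

/-- `ω_+`, the leading coefficient of `ω_N(ζ) = ω_+ + ω_0 ζ + ω_- ζ²`. -/
def omegaPlus {ι : Type*} [Fintype ι] {j : ℕ} (x : Hol ι → Coeff ι j)
    (p : ι → ℤ → Hol ι → ℂ) (q : Hol ι) (X Y : Hol ι) : ℂ :=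
  omegaN x p 0 q X Y

/-- `ω_0 = ω_3`, the next coefficient of `ω_N(ζ)`, as a complex-valued form. -/
def omegaZero {ι : Type*} [Fintype ι] {j : ℕ} (x : Hol ι → Coeff ι j)
    (p : ι → ℤ → Hol ι → ℂ) (q : Hol ι) (X Y : Hol ι) : ℂ :=
  omegaN x p 1 q X Y

/-- The real form `ω_1`, where `ω_+ = (ω_1 + i ω_2)/2`. -/
def omega1 {ι : Type*} [Fintype ι] {j : ℕ} (x : Hol ι → Coeff ι j)
    (p : ι → ℤ → Hol ι → ℂ) (q : Hol ι) (X Y : Hol ι) : ℝ :=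
  2 * (omegaPlus x p q X Y).re

/-- The real form `ω_2`, where `ω_+ = (ω_1 + i ω_2)/2`. -/
def omega2 {ι : Type*} [Fintype ι] {j : ℕ} (x : Hol ι → Coeff ι j)
    (p : ι → ℤ → Hol ι → ℂ) (q : Hol ι) (X Y : Hol ι) : ℝ :=
  2 * (omegaPlus x p q X Y).im

/-- The real form `ω_3`. -/
def omega3 {ι : Type*} [Fintype ι] {j : ℕ} (x : Hol ι → Coeff ι j)
    (p : ι → ℤ → Hol ι → ℂ) (q : Hol ι) (X Y : Hol ι) : ℝ :=
  (omegaZero x p q X Y).re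

/-- The 2-forms `ω₁, ω₂, ω₃` on a tangent space form a hyperkähler triple, with the complex
structures `I₁ = ω₃⁻¹ ω₂`, `I₂ = ω₁⁻¹ ω₃`, `I₃ = ω₂⁻¹ ω₁` and with the metric
`g(X,Y) = -ω₁(X, I₁Y) = -ω₂(X, I₂Y) = -ω₃(X, I₃Y)`. The forms determine `I₁, I₂, I₃` and `g`. -/
structure IsHyperkahlerTriple {T : Type*} [AddCommGroup T] [Module ℝ T]
    (ω₁ ω₂ ω₃ : T → T → ℝ) (I₁ I₂ I₃ : T →ₗ[ℝ] T) (g : T → T → ℝ) : Prop where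
  nondegenerate₁ : ∀ X, (∀ Y, ω₁ X Y = 0) → X = 0
  nondegenerate₂ : ∀ X, (∀ Y, ω₂ X Y = 0) → X = 0
  nondegenerate₃ : ∀ X, (∀ Y, ω₃ X Y = 0) → X = 0
  ratio₁ : ∀ X Y, ω₂ X Y = ω₃ (I₁ X) Y
  ratio₂ : ∀ X Y, ω₃ X Y = ω₁ (I₂ X) Y
  ratio₃ : ∀ X Y, ω₁ X Y = ω₂ (I₃ X) Y
  sq₁ : I₁ ∘ₗ I₁ = -LinearMap.id
  sq₂ : I₂ ∘ₗ I₂ = -LinearMap.id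
  sq₃ : I₃ ∘ₗ I₃ = -LinearMap.id
  mul₁₂ : I₁ ∘ₗ I₂ = I₃
  metric₁ : ∀ X Y, g X Y = -ω₁ X (I₁ Y)
  metric₂ : ∀ X Y, g X Y = -ω₂ X (I₂ Y)
  metric₃ : ∀ X Y, g X Y = -ω₃ X (I₃ Y)

/-! ### The Legendre transform of `L` -/

/-- The (generalized) Legendre transform
`κ = L + i u_I x^I_{j-1} - i ū_I conj(x^I_{j-1})`, evaluated at the extremum. Since `x^I_0` is
real, this is `L - 2 (Im u_I) x^I_0` for `j = 1`. -/
def kappa {ι : Type*} [Fintype ι] {j : ℕ} (L : Coeff ι j → ℂ) (x : Hol ι → Coeff ι j)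
    (q : Hol ι) : ℂ :=
  L (x q) + Complex.I * ∑ I, q.2 I * coef (x q) I ((j : ℤ) - 1)
    - Complex.I * ∑ I, conj (q.2 I) * conj (coef (x q) I ((j : ℤ) - 1))

/-- The value `(∂̄f)(Y) = (df(Y) + i df(iY))/2` at the point `q`. -/
def dbar {ι : Type*} [Fintype ι] (f : Hol ι → ℂ) (q Y : Hol ι) : ℂ :=
  (fderiv ℝ f q Y + Complex.I * fderiv ℝ f q (Complex.I • Y)) / 2

/-- The 2-form `∂∂̄f = d(∂̄f)`, on constant vector fields `X`, `Y`, in the normalization of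
`wedge`. -/
def ddbar {ι : Type*} [Fintype ι] (f : Hol ι → ℂ) (q X Y : Hol ι) : ℂ :=
  (fderiv ℝ (fun r => dbar f r Y) q X - fderiv ℝ (fun r => dbar f r X) q Y) / 2

/-! ### The matrices in the formulas -/

/-- The matrix `L_{ab}`. -/
def hessInner {ι : Type*} [Fintype ι] [DecidableEq ι] {j : ℕ} (L : Coeff ι j → ℂ)
    (x : Coeff ι j) : Matrix (ι × Inner j) (ι × Inner j) ℂ :=
  fun a b => d2 L a.1 (a.2 : ℤ) b.1 (b.2 : ℤ) x

/-- The index `m = j - 1`. -/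
def top {j : ℕ} (hj : 1 ≤ j) : Inner j :=
  ⟨(j : ℤ) - 1, by rw [Finset.mem_Icc]; omega⟩

/-- The index `m = 1 - j`. -/
def bot {j : ℕ} (hj : 1 ≤ j) : Inner j :=
  ⟨1 - (j : ℤ), by rw [Finset.mem_Icc]; omega⟩

/-- The matrix `Φ^{I J̄}`: the submatrix `L^{x^I_{j-1} x^J_{1-j}}` of the inverse `L^{ab}` of
`L_{ab}`. -/
def PhiUp {ι : Type*} [Fintype ι] [DecidableEq ι] {j : ℕ} (hj : 1 ≤ j) (L : Coeff ι j → ℂ)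
    (x : Coeff ι j) : Matrix ι ι ℂ :=
  fun I J => (hessInner L x)⁻¹ (I, top hj) (J, bot hj)

/-- The inverse matrix `Φ_{J̄ I}` of `Φ^{I J̄}`, with row index `J` and column index `I`. -/
def PhiInv {ι : Type*} [Fintype ι] [DecidableEq ι] {j : ℕ} (hj : 1 ≤ j) (L : Coeff ι j → ℂ)
    (x : Coeff ι j) : Matrix ι ι ℂ :=
  (PhiUp hj L x)⁻¹

/-- The matrix `Φ_{I J̄}`, the complex conjugate of the matrix `Φ_{Ī J}`. -/
def PhiDown {ι : Type*} [Fintype ι] [DecidableEq ι] {j : ℕ} (hj : 1 ≤ j) (L : Coeff ι j → ℂ)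
    (x : Coeff ι j) : Matrix ι ι ℂ :=
  fun I J => conj (PhiInv hj L x I J)

/-- `A_{IJ} = -i L_{x^I_j a} L^{a x^P_{1-j}} Φ_{P̄ J}`. -/
def AMat {ι : Type*} [Fintype ι] [DecidableEq ι] {j : ℕ} (hj : 1 ≤ j) (L : Coeff ι j → ℂ)
    (x : Coeff ι j) : Matrix ι ι ℂ :=
  fun I J => -Complex.I * ∑ a : ι × Inner j, ∑ P,
    d2 L I (j : ℤ) a.1 (a.2 : ℤ) x * (hessInner L x)⁻¹ a (P, bot hj) * PhiInv hj L x P J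

/-- The 1-form `du_I + dz^P A_{PI}` for a matrix `A`. -/
def theta {ι : Type*} [Fintype ι] (A : Matrix ι ι ℂ) (I : ι) : Hol ι →L[ℝ] ℂ :=
  du I + ∑ P, A P I • dz P

end GLT

end

namespace GLT

/-! ### Differentiating contour integrals; the Hankel form of the Hessian. -/

section Potential

variable {ι B : Type*} [Fintype ι] {j : ℕ}

/-! The contour integral enters mainly through its second derivatives: `L_{x^I_m x^J_n}` is the
integral of `ζ^{-(m+n)} H_{IJ}`, hence equals some `h(m+n)_{IJ}` symmetric in `I, J`
(`IsContourPotentialAt.exists_hankel`). Reality of `L` adds `conj h(k) = (-1)^k h(-k)` at real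
points (`conj_d2`). So `M = (L_{ab})` is a block Hankel matrix, and its inverse `N` is symmetric and
compatible with the signed reversal `m ↦ -m`. This gives the Hermiticity of `Φ` and the formula for
`Ā`.

The equations for `L_{x_m}`, `|m| ≤ j-1`, have explicit right-hand sides in `u, ū`. Their
differentials form a linear system with matrix `M` for the inner `dx_a`; solving it gives `dx_{j-1}`
and `dp_{-j} = i dL_{x_j}`. In `ω_3` the (2,0) part cancels because `N` and `h` are symmetric. The
(1,1) part is the asserted one provided that `h(0) - R_j N R_{-j}ᵀ = Φ_{IJ̄} + A Φ A^†`, where `R_k`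
is the block row `h(k + ·)`. This identity, a Monge–Ampère equation (`transpose_block_mul_schur`),
and the symmetry of `A` (`transpose_block_mul_hankelRow_isSymm`, `AMat_isSymm`) are the two
nontrivial algebraic facts. Both come from shifting the Hankel matrix by one step.

The rest is linear algebra. Since `A` is symmetric, `ω_+ = θ_I ∧ dz^I` with `θ_I = du_I + dz^P
A_{PI}`. In the coframe `(dz, θ)` an antilinear map `J₂` exchanges the two halves by means of
`Φ^{IJ̄}` and `Φ_{IJ̄}`. It satisfies `ω_3 = ω_1(J₂ ·, ·)`, and `J₂² = -1` because these matrices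
are inverse up to transposition. With multiplication by `i` as `I_3`, the quaternion relations and
the metric follow formally (`isHyperkahlerTriple_of_antilinear`).

For the potential, extremality removes the inner `dx_a` from `dκ`, leaving `∂̄κ = i conj(p_{-j} dz -
x_{j-1} du)`. Its differential gives `-i∂∂̄κ = conj ω_3`, and `ω_3` is real. -/

theorem hasFDerivAt_intervalIntegral_of_continuousOn {E : Type*} [NormedAddCommGroup E]
    [NormedSpace ℂ E] {s : Set E} {x₀ : E} (hs : IsCompact s) (hx₀ : s ∈ 𝓝 x₀)
    {F : E → ℝ → ℂ} {F' : E → ℝ → E →L[ℂ] ℂ}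
    (hF : ContinuousOn (Function.uncurry F) (s ×ˢ Set.Icc 0 1))
    (hF' : ContinuousOn (Function.uncurry F') (s ×ˢ Set.Icc 0 1))
    (hd : ∀ x ∈ s, ∀ t ∈ Set.Icc (0 : ℝ) 1, HasFDerivAt (fun y => F y t) (F' x t) x) :
    HasFDerivAt (fun x => ∫ t in (0 : ℝ)..1, F x t) (∫ t in (0 : ℝ)..1, F' x₀ t) x₀ := by
  have hsub : Set.uIoc (0 : ℝ) 1 ⊆ Set.Icc 0 1 := by
    rw [Set.uIoc_of_le zero_le_one]; exact Set.Ioc_subset_Icc_self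
  have slice {x : E} (hx : x ∈ s) :
      Set.MapsTo (fun t : ℝ => (x, t)) (Set.Icc 0 1) (s ×ˢ Set.Icc 0 1) := fun t ht => ⟨hx, ht⟩
  -- Compactness of `s × [0,1]` makes a constant serve as the dominating function.
  obtain ⟨C, hC⟩ := (hs.prod isCompact_Icc).exists_bound_of_continuousOn hF'
  refine intervalIntegral.hasFDerivAt_integral_of_dominated_of_fderiv_le (𝕜 := ℂ)
    (bound := fun _ => C) hx₀ ?_ ?_ ?_ ?_ intervalIntegrable_const ?_
  · filter_upwards [hx₀] with x hx
    exact ((hF.comp (by fun_prop) (slice hx)).mono hsub).aestronglyMeasurable measurableSet_uIoc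
  · refine ContinuousOn.intervalIntegrable ?_
    rw [Set.uIcc_of_le zero_le_one]
    exact hF.comp (by fun_prop) (slice (mem_of_mem_nhds hx₀))
  · exact ((hF'.comp (by fun_prop) (slice (mem_of_mem_nhds hx₀))).mono hsub).aestronglyMeasurable measurableSet_uIoc
  · exact Filter.Eventually.of_forall fun t ht x hx => hC (x, t) ⟨hx, hsub ht⟩
  · exact Filter.Eventually.of_forall fun t ht x hx => hd x hx t (hsub ht)

/-- The holomorphic function `ζ^{-n} ∂H/∂y^I`. -/
noncomputable def FunctionElement.partialDeriv [DecidableEq ι] (f : FunctionElement ι) (I : ι) (n : ℤ) :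
    FunctionElement ι where
  dom := f.dom ∩ {r | r.2 ≠ 0}
  isOpen_dom := f.isOpen_dom.inter (isOpen_ne_fun continuous_snd continuous_const)
  toFun r := r.2 ^ (-n) * fderiv ℂ f.toFun r (Pi.single I 1, 0)
  analytic := by
    intro r hr
    refine AnalyticAt.mul (analyticAt_snd.zpow hr.2) ?_
    exact ((ContinuousLinearMap.apply ℂ ℂ ((Pi.single I 1, 0) : (ι → ℂ) × ℂ)).analyticAt _).comp
      (f.analytic r hr.1).fderiv

/-- `x ↦ x_{NS}(ζ)` as a linear map. -/
noncomputable def tropicalCLM (ι : Type*) [Fintype ι] (j : ℕ) (ζ : ℂ) : Coeff ι j →L[ℂ] (ι → ℂ) :=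
  ContinuousLinearMap.pi fun I => ∑ n : Idx j, ζ ^ (-(n : ℤ)) • ContinuousLinearMap.proj (I, n)

theorem tropicalCLM_apply (ζ : ℂ) (x : Coeff ι j) : tropicalCLM ι j ζ x = tropical x ζ := by
  ext I
  simp [tropicalCLM, tropical, mul_comm]

theorem tropicalCLM_eq_sum [DecidableEq ι] (ζ : ℂ) (v : Coeff ι j) :
    tropicalCLM ι j ζ v = ∑ k : ι × Idx j, (v k * ζ ^ (-(k.2 : ℤ))) • Pi.single k.1 (1 : ℂ) := by
  rw [tropicalCLM_apply]
  ext I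
  simp [tropical, Fintype.sum_prod_type, Finset.sum_apply, Pi.single_apply]

omit [Fintype ι] in
theorem continuousOn_tropical {γ : ℝ → ℂ} (hγ : ContinuousOn γ (Set.Icc 0 1))
    (h0 : ∀ t ∈ Set.Icc (0 : ℝ) 1, γ t ≠ 0) (s : Set (Coeff ι j)) :
    ContinuousOn (fun r : Coeff ι j × ℝ => (tropical r.1 (γ r.2), γ r.2))
      (s ×ˢ Set.Icc 0 1) := by
  have hγ' : ContinuousOn (fun r : Coeff ι j × ℝ => γ r.2) (s ×ˢ Set.Icc 0 1) :=
    hγ.comp continuousOn_snd fun r hr => hr.2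
  refine ContinuousOn.prodMk ?_ hγ'
  refine continuousOn_pi.2 fun I => continuousOn_finsetSum _ fun n _ => ?_
  refine ContinuousOn.mul ?_ (hγ'.zpow₀ _ fun r hr => Or.inl (h0 _ hr.2))
  fun_prop

/-- The tube lemma along each of the finitely many compact arcs, the domains of the branches being
open. -/
theorem Contour.Admissible.eventually {H : B → FunctionElement ι} {C : Contour B}
    {x₀ : Coeff ι j} (h : C.Admissible H x₀) : ∀ᶠ x in 𝓝 x₀, C.Admissible H x := by
  induction C with
  | nil => simp [Contour.Admissible]
  | cons γ C ih =>
    have h1 := ih fun γ' hγ' => h γ' (List.mem_cons_of_mem _ hγ')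
    have h2 : ∀ᶠ x in 𝓝 x₀, ∀ t ∈ Set.Icc (0 : ℝ) 1,
        (tropical x (γ.path t), γ.path t) ∈ (H γ.branch).dom := by
      refine isCompact_Icc.eventually_forall_of_forall_eventually fun t ht => ?_
      have hc : ContinuousAt (fun r : Coeff ι j × ℝ => (tropical r.1 (γ.path r.2), γ.path r.2))
          (x₀, t) := by
        have hγ : ContinuousAt (fun r : Coeff ι j × ℝ => γ.path r.2) (x₀, t) :=
          (γ.contDiff.continuous.comp continuous_snd).continuousAt
        refine ContinuousAt.prodMk ?_ hγ
        refine continuousAt_pi.2 fun I => tendsto_finsetSum _ fun n _ => ?_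
        refine ContinuousAt.mul ?_ (hγ.zpow₀ _ (Or.inl (γ.ne_zero t ht)))
        fun_prop
      have := hc.eventually_mem ((H γ.branch).isOpen_dom.mem_nhds (h γ (by simp) t ht))
      rw [nhds_prod_eq] at this ⊢
      exact this
    filter_upwards [h1, h2] with x hx1 hx2 γ' hγ'
    rcases List.mem_cons.1 hγ' with rfl | hγ'
    · exact hx2
    · exact hx1 γ' hγ'

theorem Contour.Admissible.partialDeriv [DecidableEq ι] {H : B → FunctionElement ι} {C : Contour B}
    {x : Coeff ι j} (h : C.Admissible H x) (I : ι) (n : ℤ) :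
    C.Admissible (fun b => (H b).partialDeriv I n) x :=
  fun γ hγ t ht => ⟨h γ hγ t ht, γ.ne_zero t ht⟩

/-- Because `∂x_{NS}(ζ)/∂x^I_m = ζ^{-m} e_I`, differentiation under the integral sign replaces `H`
by `partialDeriv I m` and keeps the shape of the integral. -/
theorem hasFDerivAt_arc_integral [DecidableEq ι] {H : B → FunctionElement ι} (γ : Arc B)
    {x₀ : Coeff ι j} (h : Contour.Admissible H [γ] x₀) :
    HasFDerivAt (fun x => ∫ t in (0 : ℝ)..1,
        deriv γ.path t / (2 * (Real.pi : ℂ) * Complex.I * γ.path t) *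
          (H γ.branch).toFun (tropical x (γ.path t), γ.path t))
      (∑ k : ι × Idx j, (∫ t in (0 : ℝ)..1,
        deriv γ.path t / (2 * (Real.pi : ℂ) * Complex.I * γ.path t) *
          ((H γ.branch).partialDeriv k.1 k.2).toFun (tropical x₀ (γ.path t), γ.path t)) •
        (ContinuousLinearMap.proj k : Coeff ι j →L[ℂ] ℂ)) x₀ := by
  set w : ℝ → ℂ := fun t => deriv γ.path t / (2 * (Real.pi : ℂ) * Complex.I * γ.path t) with hw
  have hwc : ContinuousOn w (Set.Icc 0 1) := by
    refine ContinuousOn.div (γ.contDiff.continuous_deriv le_rfl).continuousOn ?_ ?_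
    · exact (continuous_const.mul γ.contDiff.continuous).continuousOn
    · intro t ht
      have := γ.ne_zero t ht
      have := Real.pi_ne_zero
      simp_all
  obtain ⟨s, hsx, hsa, hs⟩ := (LocallyCompactSpace.local_compact_nhds x₀ _ h.eventually)
  have key (f : FunctionElement ι) (hf : ∀ x ∈ s, ∀ t ∈ Set.Icc (0 : ℝ) 1,
      (tropical x (γ.path t), γ.path t) ∈ f.dom) :
      ContinuousOn (fun r : Coeff ι j × ℝ =>
        w r.2 * f.toFun (tropical r.1 (γ.path r.2), γ.path r.2)) (s ×ˢ Set.Icc 0 1) :=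
    (hwc.comp continuousOn_snd fun r hr => hr.2).mul
      (f.analytic.continuousOn.comp
        (continuousOn_tropical γ.contDiff.continuous.continuousOn γ.ne_zero s)
        fun r hr => hf r.1 hr.1 r.2 hr.2)
  have hdom : ∀ x ∈ s, ∀ t ∈ Set.Icc (0 : ℝ) 1,
      (tropical x (γ.path t), γ.path t) ∈ (H γ.branch).dom :=
    fun x hx t ht => hsa hx γ (by simp) t ht
  have hdom' (k : ι × Idx j) : ∀ x ∈ s, ∀ t ∈ Set.Icc (0 : ℝ) 1,
      (tropical x (γ.path t), γ.path t) ∈ ((H γ.branch).partialDeriv k.1 k.2).dom :=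
    fun x hx t ht => (Contour.Admissible.partialDeriv (hsa hx) k.1 k.2) γ (by simp) t ht
  have hint (k : ι × Idx j) : IntervalIntegrable (fun t => w t *
      ((H γ.branch).partialDeriv k.1 k.2).toFun (tropical x₀ (γ.path t), γ.path t))
      MeasureTheory.volume 0 1 := by
    refine ContinuousOn.intervalIntegrable ?_
    rw [Set.uIcc_of_le zero_le_one]
    exact (key _ (hdom' k)).comp (f := fun t : ℝ => (x₀, t)) (by fun_prop)
      fun t ht => ⟨mem_of_mem_nhds hsx, ht⟩
  have hint' (k : ι × Idx j) : IntervalIntegrable (fun t => (w t *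
      ((H γ.branch).partialDeriv k.1 k.2).toFun (tropical x₀ (γ.path t), γ.path t)) •
        (ContinuousLinearMap.proj k : Coeff ι j →L[ℂ] ℂ)) MeasureTheory.volume 0 1 :=
    ⟨(hint k).1.smul_const _, (hint k).2.smul_const _⟩
  have := hasFDerivAt_intervalIntegral_of_continuousOn hs hsx
    (F := fun x t => w t * (H γ.branch).toFun (tropical x (γ.path t), γ.path t))
    (F' := fun x t => ∑ k : ι × Idx j, (w t * ((H γ.branch).partialDeriv k.1 k.2).toFun
      (tropical x (γ.path t), γ.path t)) • (ContinuousLinearMap.proj k : Coeff ι j →L[ℂ] ℂ))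
    (key _ hdom)
    (continuousOn_finsetSum _ fun k _ => (key _ (hdom' k)).smul continuousOn_const) ?_
  · rw [intervalIntegral.integral_finsetSum
      fun k _ => hint' k] at this
    simpa only [intervalIntegral.integral_smul_const] using this
  · intro x hx t ht
    have h1 : HasFDerivAt (fun y : Coeff ι j => (tropical y (γ.path t), γ.path t))
        ((tropicalCLM ι j (γ.path t)).prod 0) x := by
      refine HasFDerivAt.prodMk ?_ (hasFDerivAt_const _ _)
      have := (tropicalCLM ι j (γ.path t)).hasFDerivAt (x := x)
      exact this.congr_of_eventuallyEq (Filter.Eventually.of_forall fun y =>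
        (tropicalCLM_apply (γ.path t) y).symm)
    have h2 := (((H γ.branch).analytic _ (hdom x hx t ht)).differentiableAt.hasFDerivAt.comp x
      h1).const_mul (w t)
    refine h2.congr_fderiv ?_
    ext v
    have h3 : ((tropicalCLM ι j (γ.path t)).prod (0 : Coeff ι j →L[ℂ] ℂ)) v =
        ∑ k : ι × Idx j, (v k * γ.path t ^ (-(k.2 : ℤ))) •
          ((Pi.single k.1 (1 : ℂ), 0) : (ι → ℂ) × ℂ) := by
      rw [ContinuousLinearMap.prod_apply, tropicalCLM_eq_sum]
      ext <;> simp [Prod.fst_sum, Prod.snd_sum]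
    simp only [smul_apply, ContinuousLinearMap.comp_apply, h3, map_sum,
      map_smul, sum_apply, ContinuousLinearMap.proj_apply, smul_eq_mul,
      Finset.mul_sum, FunctionElement.partialDeriv]
    exact Finset.sum_congr rfl fun k _ => by ring

theorem Contour.Admissible.hasFDerivAt_potential [DecidableEq ι] {H : B → FunctionElement ι}
    {C : Contour B} {x : Coeff ι j} (h : C.Admissible H x) :
    HasFDerivAt (fun y => C.potential H y) (∑ k : ι × Idx j,
      C.potential (fun b => (H b).partialDeriv k.1 k.2) x •
        (ContinuousLinearMap.proj k : Coeff ι j →L[ℂ] ℂ)) x := by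
  induction C with
  | nil =>
    refine (hasFDerivAt_const (𝕜 := ℂ) (0 : ℂ) x).congr_fderiv ?_
    ext v
    simp [Contour.potential]
  | cons γ C ih =>
    have h1 := ih fun γ' hγ' => h γ' (List.mem_cons_of_mem _ hγ')
    have h2 := hasFDerivAt_arc_integral (H := H) γ (x₀ := x) fun γ' hγ' =>
      h γ' (by simp_all)
    refine (h2.add h1).congr_fderiv ?_
    ext v
    simp [Contour.potential, Finset.sum_add_distrib, add_mul]

theorem Contour.Admissible.d1_potential [DecidableEq ι] {H : B → FunctionElement ι}
    {C : Contour B} {x : Coeff ι j} (h : C.Admissible H x) (I : ι) {m : ℤ}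
    (hm : m ∈ Finset.Icc (-(j : ℤ)) j) :
    d1 (fun y => C.potential H y) I m x =
      C.potential (fun b => (H b).partialDeriv I m) x := by
  rw [d1, h.hasFDerivAt_potential.fderiv]
  simp only [sum_apply, smul_apply,
    ContinuousLinearMap.proj_apply, smul_eq_mul, dir]
  rw [Finset.sum_eq_single (I, ⟨m, hm⟩)]
  · simp
  · intro k _ hk
    rw [if_neg, mul_zero]
    rintro ⟨h1, h2⟩
    exact hk (Prod.ext h1 (Subtype.ext h2))
  · simp

theorem IsContourPotentialAt.eventually [DecidableEq ι] {H : B → FunctionElement ι}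
    {L : Coeff ι j → ℂ} {x₀ : Coeff ι j} (h : IsContourPotentialAt H L x₀) :
    ∀ᶠ x in 𝓝 x₀, IsContourPotentialAt H L x := by
  obtain ⟨C, hC, hL⟩ := h
  filter_upwards [hC.eventually, hL.eventually_nhds] with x h1 h2 using ⟨C, h1, h2⟩

theorem IsContourPotentialAt.differentiableAt [DecidableEq ι] {H : B → FunctionElement ι}
    {L : Coeff ι j → ℂ} {x : Coeff ι j} (h : IsContourPotentialAt H L x) :
    DifferentiableAt ℂ L x := by
  obtain ⟨C, hC, hL⟩ := h
  exact (hC.hasFDerivAt_potential.congr_of_eventuallyEq hL).differentiableAt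

/-- Contour potentials are closed under differentiation, so second derivatives need no separate
analysis. -/
theorem IsContourPotentialAt.d1 [DecidableEq ι] {H : B → FunctionElement ι}
    {L : Coeff ι j → ℂ} {x₀ : Coeff ι j} (h : IsContourPotentialAt H L x₀) (I : ι) {m : ℤ}
    (hm : m ∈ Finset.Icc (-(j : ℤ)) j) :
    IsContourPotentialAt (fun b => (H b).partialDeriv I m) (fun x => d1 L I m x) x₀ := by
  obtain ⟨C, hC, hL⟩ := h
  refine ⟨C, hC.partialDeriv I m, ?_⟩
  filter_upwards [hC.eventually, hL.eventually_nhds] with x h1 h2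
  rw [← h1.d1_potential I hm, GLT.d1, GLT.d1, Filter.EventuallyEq.fderiv_eq h2]

/-- The source of the Hankel structure: the two powers of `ζ` combine, and `m`, `n` enter only
through `m + n`. -/
theorem FunctionElement.partialDeriv_partialDeriv [DecidableEq ι] (f : FunctionElement ι) (I J : ι)
    (m n : ℤ) {r : (ι → ℂ) × ℂ} (hr : r ∈ f.dom) (h0 : r.2 ≠ 0) :
    ((f.partialDeriv J n).partialDeriv I m).toFun r = r.2 ^ (-(m + n)) *
      fderiv ℂ (fderiv ℂ f.toFun) r (Pi.single I 1, 0) (Pi.single J 1, 0) := by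
  have h2 : HasFDerivAt (fun r => fderiv ℂ f.toFun r (Pi.single J 1, 0))
      ((fderiv ℂ (fderiv ℂ f.toFun) r).flip (Pi.single J 1, 0)) r := by
    have := ((f.analytic r hr).fderiv.differentiableAt.hasFDerivAt).clm_apply
      (hasFDerivAt_const ((Pi.single J 1, 0) : (ι → ℂ) × ℂ) r)
    simpa using this
  have h1 : HasFDerivAt (fun r : (ι → ℂ) × ℂ => r.2 ^ (-n))
      (((-n : ℤ) * r.2 ^ (-n - 1) : ℂ) • ContinuousLinearMap.snd ℂ (ι → ℂ) ℂ) r := by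
    have := (hasDerivAt_zpow (-n) r.2 (Or.inl h0)).comp_hasFDerivAt r
      (hasFDerivAt_snd (𝕜 := ℂ) (p := r))
    exact this.congr_fderiv (by simp)
  have h3 := (h1.mul h2).fderiv
  change r.2 ^ (-m) * fderiv ℂ (fun r => r.2 ^ (-n) * fderiv ℂ f.toFun r (Pi.single J 1, 0)) r
    (Pi.single I 1, 0) = _
  rw [show (fun r : (ι → ℂ) × ℂ => r.2 ^ (-n) * fderiv ℂ f.toFun r (Pi.single J 1, 0)) =
    (fun r : (ι → ℂ) × ℂ => r.2 ^ (-n)) * fun r => fderiv ℂ f.toFun r (Pi.single J 1, 0)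
    from rfl, h3]
  -- The direction has no `ζ`-component, so the derivative of the factor `ζ^{-n}` drops out.
  simp only [add_apply, smul_apply,
    ContinuousLinearMap.flip_apply, ContinuousLinearMap.coe_snd', smul_eq_mul, mul_zero, add_zero]
  rw [neg_add, zpow_add₀ h0, mul_assoc]

/-- The Hessian of a contour-integral potential is a block Hankel matrix. -/
theorem IsContourPotentialAt.exists_hankel [DecidableEq ι] {H : B → FunctionElement ι}
    {L : Coeff ι j → ℂ} {x : Coeff ι j} (h : IsContourPotentialAt H L x) :
    ∃ h : ℤ → ι → ι → ℂ, (∀ k I J, h k I J = h k J I) ∧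
      ∀ m ∈ Finset.Icc (-(j : ℤ)) j, ∀ n ∈ Finset.Icc (-(j : ℤ)) j, ∀ I J,
        d2 L I m J n x = h (m + n) I J := by
  obtain ⟨C, hC, hL⟩ := h
  refine ⟨fun k I J => (C.map fun γ => ∫ t in (0 : ℝ)..1,
    deriv γ.path t / (2 * (Real.pi : ℂ) * Complex.I * γ.path t) * (γ.path t ^ (-k) *
      fderiv ℂ (fderiv ℂ (H γ.branch).toFun) (tropical x (γ.path t), γ.path t)
        (Pi.single I 1, 0) (Pi.single J 1, 0))).sum, fun k I J => ?_, fun m hm n hn I J => ?_⟩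
  · refine congrArg List.sum (List.map_congr_left fun γ hγ => intervalIntegral.integral_congr
      fun t ht => ?_)
    rw [Set.uIcc_of_le zero_le_one] at ht
    have : IsSymmSndFDerivAt ℂ (H γ.branch).toFun (tropical x (γ.path t), γ.path t) :=
      (((H γ.branch).analytic _ (hC γ hγ t ht)).contDiffAt (n := ⊤)).isSymmSndFDerivAt (by simp)
    simp only [this.eq (Pi.single I 1, 0)]
  · have h1 : (fun y => GLT.d1 L J n y) =ᶠ[𝓝 x]
        fun y => C.potential (fun b => (H b).partialDeriv J n) y := by
      filter_upwards [hC.eventually, hL.eventually_nhds] with x h1 h2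
      rw [← h1.d1_potential J hn, GLT.d1, GLT.d1, Filter.EventuallyEq.fderiv_eq h2]
    have h2 := (hC.partialDeriv J n).d1_potential I hm
    rw [GLT.d1] at h2
    rw [d2, h1.fderiv_eq, h2]
    refine congrArg List.sum (List.map_congr_left fun γ hγ => intervalIntegral.integral_congr
      fun t ht => ?_)
    rw [Set.uIcc_of_le zero_le_one] at ht
    simp only [FunctionElement.partialDeriv_partialDeriv _ I J m n (hC γ hγ t ht)
      (γ.ne_zero t ht)]

end Potential

/-! ### Two identities for inverses of block Hankel matrices. -/

section Hankel

open Matrix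

variable {ι : Type*} [Fintype ι] [DecidableEq ι] {j : ℕ}

/-- The block Hankel matrix with the entries `h (m + n) I J`. -/
def hankel (j : ℕ) (h : ℤ → ι → ι → ℂ) : Matrix (ι × Inner j) (ι × Inner j) ℂ :=
  of fun a b => h (a.2 + b.2) a.1 b.1

/-- The block row of index `k` of the infinite Hankel matrix. -/
def hankelRow (j : ℕ) (h : ℤ → ι → ι → ℂ) (k : ℤ) : Matrix ι (ι × Inner j) ℂ :=
  of fun I a => h (k + a.2) I a.1

/-- The block of block-indices `m`, `n`. -/
def block (N : Matrix (ι × Inner j) (ι × Inner j) ℂ) (m n : Inner j) : Matrix ι ι ℂ :=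
  N.submatrix (fun I => (I, m)) (fun I => (I, n))

/-- The block column of block-index `n`. -/
def blockCol (N : Matrix (ι × Inner j) (ι × Inner j) ℂ) (n : Inner j) :
    Matrix (ι × Inner j) ι ℂ :=
  N.submatrix id (fun I => (I, n))

omit [Fintype ι] [DecidableEq ι] in
theorem hankel_isSymm {h : ℤ → ι → ι → ℂ} (hs : ∀ k I J, h k I J = h k J I) :
    (hankel j h).IsSymm := by
  ext a b
  simp only [hankel, transpose_apply, of_apply, add_comm (b.2 : ℤ)]
  exact hs _ _ _

theorem hankel_inv_isSymm {h : ℤ → ι → ι → ℂ} (hs : ∀ k I J, h k I J = h k J I) :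
    (hankel j h)⁻¹.IsSymm := by
  rw [IsSymm, transpose_nonsing_inv, (hankel_isSymm hs).eq]

/-- The block row following those of the Hankel matrix, applied to a column of its inverse. -/
theorem transpose_block_mul_hankelRow_isSymm (hj : 1 ≤ j) {h : ℤ → ι → ι → ℂ}
    (hs : ∀ k I J, h k I J = h k J I) (hdet : IsUnit (hankel j h).det) :
    ((block (hankel j h)⁻¹ (top hj) (bot hj))ᵀ *
      (hankelRow j h j * blockCol (hankel j h)⁻¹ (bot hj))).IsSymm := by
  set N := (hankel j h)⁻¹ with hN
  have hMN : hankel j h * N = 1 := mul_nonsing_inv _ hdet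
  -- Row `m` of the matrix shifted by one is row `m + 1` of the Hankel matrix. Against the column
  -- `1-j` of `N` it gives a Kronecker delta, which vanishes as `m + 1 > 1-j`. Only `m = j-1` leads
  -- out of the matrix.
  have shift (J : ι) (a : ι × Inner j) :
      ∑ b : ι × Inner j, h (a.2 + b.2 + 1) a.1 b.1 * N b (J, bot hj) =
        if a.2 = top hj then (hankelRow j h j * blockCol N (bot hj)) a.1 J else 0 := by
    obtain ⟨I, m, hm⟩ := a
    have hm' := Finset.mem_Icc.1 hm
    split_ifs with ha
    · simp only [top, Subtype.mk.injEq] at ha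
      subst ha
      simp only [mul_apply, hankelRow, blockCol, of_apply, submatrix_apply, id]
      refine Finset.sum_congr rfl fun b _ => ?_
      congr 2; ring
    · have ha' : m ≠ (j : ℤ) - 1 := fun h => ha (Subtype.ext h)
      have hm1 : m + 1 ∈ Finset.Icc (1 - (j : ℤ)) (j - 1) := by rw [Finset.mem_Icc]; omega
      have := congrFun (congrFun hMN (I, ⟨m + 1, hm1⟩)) (J, bot hj)
      rw [one_apply_ne (by simp only [bot, ne_eq, Prod.mk.injEq, Subtype.mk.injEq]; omega),
        mul_apply] at this
      rw [← this]
      refine Finset.sum_congr rfl fun b _ => ?_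
      simp only [hankel, of_apply]
      congr 2; ring
  -- The product is thus `Vᵀ M⁺ V`, with `V` the block column `1-j` of `N` and `M⁺` the shifted
  -- Hankel matrix, which is again symmetric.
  have key (I J : ι) : ((block N (top hj) (bot hj))ᵀ *
      (hankelRow j h j * blockCol N (bot hj))) I J =
      ∑ a : ι × Inner j, ∑ b : ι × Inner j,
        N a (I, bot hj) * (h (a.2 + b.2 + 1) a.1 b.1 * N b (J, bot hj)) := by
    simp_rw [← Finset.mul_sum, shift]
    rw [mul_apply, Fintype.sum_prod_type]
    refine Finset.sum_congr rfl fun K _ => ?_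
    simp [block]
  ext I J
  rw [transpose_apply, key, key, Finset.sum_comm]
  refine Finset.sum_congr rfl fun a _ => Finset.sum_congr rfl fun b _ => ?_
  rw [hs, add_comm (a.2 : ℤ)]
  ring

/-- The determinantal identity behind the Monge–Ampère equation: deleting from the Hankel matrix
the first block row and the last block column gives the same matrix as deleting the last block row
and the first block column from the Hankel matrix shifted by one. -/
theorem transpose_block_mul_schur (hj : 1 ≤ j) {h : ℤ → ι → ι → ℂ}
    (hs : ∀ k I J, h k I J = h k J I) (hdet : IsUnit (hankel j h).det)
    (hPhi : IsUnit (block (hankel j h)⁻¹ (top hj) (bot hj)).det) :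
    (block (hankel j h)⁻¹ (top hj) (bot hj))ᵀ *
      (of (h 0) - hankelRow j h j * (hankel j h)⁻¹ * (hankelRow j h (-j))ᵀ +
        hankelRow j h j * blockCol (hankel j h)⁻¹ (bot hj) *
          (block (hankel j h)⁻¹ (top hj) (bot hj))⁻¹ *
          ((blockCol (hankel j h)⁻¹ (top hj))ᵀ * (hankelRow j h (-j))ᵀ)) = 1 := by
  set M := hankel j h with hM
  set N := M⁻¹ with hN
  set Φ := block N (top hj) (bot hj) with hΦ
  set R := (hankelRow j h (-j))ᵀ with hR
  set Y := (blockCol N (top hj))ᵀ * R with hY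
  set S := of (h 0) - hankelRow j h j * N * R +
    hankelRow j h j * blockCol N (bot hj) * Φ⁻¹ * Y with hS
  have hMN : M * N = 1 := mul_nonsing_inv _ hdet
  have hNM : N * M = 1 := nonsing_inv_mul _ hdet
  have hNs : N.IsSymm := hankel_inv_isSymm hs
  -- `N * R` solves `M Z = R`. The correction by the column `1-j` of `N` makes the top block of `Z`
  -- vanish and spoils only the block row `1-j` of that equation.
  set Z : Matrix (ι × Inner j) ι ℂ := N * R - blockCol N (bot hj) * Φ⁻¹ * Y with hZ
  have hMV : M * blockCol N (bot hj) = of fun (a : ι × Inner j) (J : ι) => if a = (J, bot hj) then (1 : ℂ) else 0 := by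
    ext a J
    have := congrFun (congrFun hMN a) (J, bot hj)
    rwa [one_apply] at this
  have hMZ : M * Z = R - (of fun (a : ι × Inner j) (J : ι) => if a = (J, bot hj) then (1 : ℂ) else 0) * (Φ⁻¹ * Y) := by
    rw [hZ, Matrix.mul_sub, ← Matrix.mul_assoc, hMN, Matrix.one_mul, ← hMV]
    simp only [Matrix.mul_assoc]
  have hZtop (K J : ι) : Z (K, top hj) J = 0 := by
    have h1 : Z.submatrix (fun I => (I, top hj)) id = Y - Φ * Φ⁻¹ * Y := by
      have : (blockCol N (top hj))ᵀ = N.submatrix (fun I => (I, top hj)) id := by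
        ext I a
        exact congrFun (congrFun hNs.eq _) _
      have hY' : Y = N.submatrix (fun I => (I, top hj)) id * R := by rw [hY, this]
      nth_rewrite 1 [hY']
      rfl
    rw [mul_nonsing_inv _ hPhi, Matrix.one_mul, sub_self] at h1
    exact congrFun (congrFun h1 K) J
  have hjZ : of (h 0) - hankelRow j h j * Z = S := by
    rw [hZ, hS, Matrix.mul_sub]
    simp only [Matrix.mul_assoc]
    abel
  ext K₀ J
  rw [one_apply]
  -- The block vector `(1, -Z)` on the range `-j, …, j-1`, extended by zero. Its entry at `j-1`
  -- vanishes, so it can be moved up by one index and still fit in the inner range.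
  set w : ι → ℤ → ℂ := fun K n => if n = -(j : ℤ) then (if K = J then 1 else 0) else
    if hn : n ∈ Finset.Icc (1 - (j : ℤ)) (j - 1) then -Z (K, ⟨n, hn⟩) J else 0 with hw
  have hw0 (K : ι) : w K (-j) = if K = J then 1 else 0 := by simp [hw]
  have hwi (K : ι) (n : Inner j) : w K n = -Z (K, n) J := by
    obtain ⟨n, hn⟩ := n
    have := Finset.mem_Icc.1 hn
    simp only [hw]
    rw [if_neg (by omega), dif_pos hn]
  -- the rows of the Hankel matrix, extended to the left, applied to `w`
  have hT (k : ℤ) (I : ι) :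
      ∑ K, (h (k - j) I K * w K (-j) + ∑ n : Inner j, h (k + n) I K * w K n) =
        (of (h (k - j)) - hankelRow j h k * Z) I J := by
    simp only [hw0, hwi, Finset.sum_add_distrib, mul_ite, mul_one, mul_zero, Finset.sum_ite_eq',
      Finset.mem_univ, if_true, Matrix.sub_apply, of_apply, mul_apply, hankelRow, Fintype.sum_prod_type,
      mul_neg, Finset.sum_neg_distrib]
    rw [← sub_eq_add_neg]
  -- The left side runs over `-j, …, j-2`; the vanishing value at `j-1` is added to complete the
  -- inner range.
  have hshift (f : ℤ → ℂ) (hf : f (j - 1) = 0) :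
      ∑ n : Inner j, f (n - 1) = f (-j) + ∑ n : Inner j, f n := by
    rw [Finset.sum_coe_sort (Finset.Icc (1 - (j : ℤ)) (j - 1)) (fun n => f (n - 1)),
      Finset.sum_coe_sort (Finset.Icc (1 - (j : ℤ)) (j - 1)) f,
      ← Finset.sum_image (g := fun n : ℤ => n - 1) (f := f) (by intro a _ b _ hab; simpa using hab)]
    have e1 : (Finset.Icc (1 - (j : ℤ)) (j - 1)).image (fun n : ℤ => n - 1) =
        (Finset.Icc (-(j : ℤ)) (j - 1)).erase (j - 1) := by
      ext n
      simp only [Finset.mem_image, Finset.mem_Icc, Finset.mem_erase]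
      constructor
      · rintro ⟨a, ha, rfl⟩; omega
      · intro hn; exact ⟨n + 1, by omega, by omega⟩
    have e2 : Finset.Icc (1 - (j : ℤ)) (j - 1) = (Finset.Icc (-(j : ℤ)) (j - 1)).erase (-j) := by
      ext n
      simp only [Finset.mem_Icc, Finset.mem_erase]
      omega
    rw [e1, e2, Finset.sum_erase _ hf, Finset.add_sum_erase _ f (by rw [Finset.mem_Icc]; omega)]
  -- Row `m` applied to the moved vector is row `m + 1`, extended to the left, applied to `w`. It
  -- vanishes by `hMZ` as long as `m + 1` is inner, and for `m = j-1` it is `S`.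
  have hMw (a : ι × Inner j) : (M *ᵥ fun b => w b.1 ((b.2 : ℤ) - 1)) a =
      if a.2 = top hj then S a.1 J else 0 := by
    obtain ⟨I, m, hm⟩ := a
    have hm' := Finset.mem_Icc.1 hm
    have e : (M *ᵥ fun b => w b.1 ((b.2 : ℤ) - 1)) (I, ⟨m, hm⟩) =
        (of (h (m + 1 - j)) - hankelRow j h (m + 1) * Z) I J := by
      rw [← hT]
      simp only [mulVec, dotProduct, Fintype.sum_prod_type]
      refine Finset.sum_congr rfl fun K _ => ?_
      have := hshift (fun n => h (m + 1 + n) I K * w K n)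
        (by have := hwi K (top hj)
            rw [hZtop, neg_zero] at this
            exact mul_eq_zero_of_right _ this)
      rw [← sub_eq_add_neg] at this
      rw [← this]
      refine Finset.sum_congr rfl fun n _ => ?_
      simp only [hM, hankel, of_apply]
      congr 2; ring
    rw [e]
    split_ifs with ha
    · simp only [top, Subtype.mk.injEq] at ha
      subst ha
      rw [show (j : ℤ) - 1 + 1 = j by ring, sub_self, hjZ]
    · have ha' : m ≠ (j : ℤ) - 1 := fun h => ha (Subtype.ext h)
      have hm1 : m + 1 ∈ Finset.Icc (1 - (j : ℤ)) (j - 1) := by rw [Finset.mem_Icc]; omega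
      have h1 := congrFun (congrFun hMZ (I, ⟨m + 1, hm1⟩)) J
      have h2 : ((of fun (a : ι × Inner j) (J : ι) => if a = (J, bot hj) then (1 : ℂ) else 0) * (Φ⁻¹ * Y))
          (I, ⟨m + 1, hm1⟩) J = 0 := by
        rw [mul_apply]
        refine Finset.sum_eq_zero fun K _ => ?_
        rw [of_apply, if_neg (by simp only [bot, Prod.mk.injEq, Subtype.mk.injEq]; omega), zero_mul]
      rw [Matrix.sub_apply, h2, sub_zero] at h1
      rw [Matrix.sub_apply, of_apply, sub_eq_zero]
      refine Eq.trans ?_ h1.symm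
      simp only [hR, hankelRow, transpose_apply, of_apply]
      rw [hs]
      congr 1; ring
  -- Hence the moved vector is the block column `j-1` of `N` times `S`. Its lowest block is `w` at
  -- `-j`, the identity, while the matching block of `N` is `Φᵀ`.
  have h1 := congrFun (congrArg (N *ᵥ ·) (funext hMw)) (K₀, bot hj)
  simp only [mulVec_mulVec, hNM, one_mulVec] at h1
  have h2 : w K₀ (((bot hj : Inner j) : ℤ) - 1) = if K₀ = J then 1 else 0 := by
    rw [← hw0]; congr 1; simp only [bot]; ring
  rw [← h2, h1]
  simp only [mul_apply, mulVec, dotProduct, Fintype.sum_prod_type, mul_ite, mul_zero,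
    Finset.sum_ite_eq', Finset.mem_univ, if_true, transpose_apply]
  refine Finset.sum_congr rfl fun K _ => ?_
  congr 1
  exact congrFun (congrFun hNs.eq _) _

end Hankel

/-! ### Consequences of the reality condition for derivatives and for the inverse Hessian. -/

section Reality

variable {ι : Type*} {j : ℕ}

theorem coef_of_mem {x : Coeff ι j} {I : ι} {m : ℤ} (hm : m ∈ Finset.Icc (-(j : ℤ)) j) :
    coef x I m = x (I, ⟨m, hm⟩) := dif_pos hm

theorem coef_add (x y : Coeff ι j) (I : ι) (m : ℤ) :
    coef (x + y) I m = coef x I m + coef y I m := by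
  unfold coef; split_ifs <;> simp

theorem coef_smul (a : ℂ) (x : Coeff ι j) (I : ι) (m : ℤ) :
    coef (a • x) I m = a * coef x I m := by
  unfold coef; split_ifs <;> simp

theorem coef_dir [DecidableEq ι] {m : ℤ} (hm : m ∈ Finset.Icc (-(j : ℤ)) j) (I K : ι) (n : ℤ) :
    coef (dir I m : Coeff ι j) K n = if K = I ∧ n = m then 1 else 0 := by
  unfold coef dir
  split_ifs <;> simp_all

theorem conj_neg_one_zpow (m : ℤ) : conj ((-1 : ℂ) ^ m) = (-1) ^ m := by
  simp [map_zpow₀]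

theorem neg_one_zpow_mul_self (m : ℤ) : (-1 : ℂ) ^ m * (-1) ^ m = 1 := by
  rw [← mul_zpow]; simp

theorem neg_one_zpow_neg (m : ℤ) : (-1 : ℂ) ^ (-m) = (-1) ^ m := by
  rw [zpow_neg, ← inv_zpow]; norm_num

theorem neg_mem_Icc {j m : ℤ} (hm : m ∈ Finset.Icc (-j) j) : -m ∈ Finset.Icc (-j) j := by
  rw [Finset.mem_Icc] at *; omega

theorem IsRealCoeff.add {x y : Coeff ι j} (hx : IsRealCoeff x) (hy : IsRealCoeff y) :
    IsRealCoeff (x + y) := fun I m => by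
  rw [coef_add, coef_add, map_add, mul_add, hx, hy]

theorem IsRealCoeff.smul {x : Coeff ι j} (hx : IsRealCoeff x) (s : ℝ) :
    IsRealCoeff ((s : ℂ) • x) := fun I m => by
  rw [coef_smul, coef_smul, map_mul, mul_left_comm, hx, Complex.conj_ofReal]

/-- With `a = 1` and `a = i` these real vectors span the directions `m` and `-m` over `ℂ`. For `m =
0` the two terms merge into `2 Re a` times one direction. -/
theorem isRealCoeff_dir_add [DecidableEq ι] {m : ℤ} (hm : m ∈ Finset.Icc (-(j : ℤ)) j) (I : ι)
    (a : ℂ) : IsRealCoeff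
      (a • dir I m + ((-1) ^ m * conj a : ℂ) • dir I (-m) : Coeff ι j) := fun K n => by
  simp only [coef_add, coef_smul, coef_dir hm, coef_dir (neg_mem_Icc hm)]
  by_cases hK : K = I
  · by_cases h1 : n = m <;> by_cases h2 : n = -m
    · have h3 : m = 0 := by omega
      subst h1; subst h3; simp [hK, add_comm]
    · subst h1
      have h3 : -n ≠ n := fun h => h2 h.symm
      simp only [hK, h3, h2, and_false, if_false, and_true, if_true, map_add, map_mul,
        conj_neg_one_zpow, Complex.conj_conj]
      simp only [mul_one, mul_zero, map_zero, map_one, add_zero, zero_add]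
      rw [← mul_assoc, neg_one_zpow_mul_self, one_mul]
    · subst h2
      have h3 : -m ≠ m := h1
      have h4 : ¬ m = -m := fun h => h3 h.symm
      simp only [neg_neg, hK, h3, h4, and_false, if_false, and_true, if_true, map_add, map_mul,
        conj_neg_one_zpow, neg_one_zpow_neg]
      simp only [mul_one, mul_zero, map_zero, map_one, add_zero, zero_add]
    · have h3 : ¬ -n = m := by omega
      have h4 : ¬ -n = -m := by omega
      simp [h1, h2, h3]
  · simp [hK]

variable [Fintype ι]

/-- The derivative of a holomorphic function that is real at real points is real. -/
theorem conj_fderiv_dir [DecidableEq ι] {f : Coeff ι j → ℂ} {x : Coeff ι j}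
    (hf : DifferentiableAt ℂ f x) (hx : IsRealCoeff x)
    (hre : ∀ᶠ y in 𝓝 x, IsRealCoeff y → (f y).im = 0) (I : ι) {m : ℤ}
    (hm : m ∈ Finset.Icc (-(j : ℤ)) j) :
    conj (fderiv ℂ f x (dir I m)) = (-1) ^ m * fderiv ℂ f x (dir I (-m)) := by
  -- The real line through `x` in a real direction stays among the real points, where `f` is real.
  have key (v : Coeff ι j) (hv : IsRealCoeff v) : (fderiv ℂ f x v).im = 0 := by
    have hline : HasDerivAt (fun s : ℝ => x + (s : ℂ) • v) v 0 := by
      have h1 : HasDerivAt (fun s : ℝ => (s : ℂ)) 1 0 := Complex.ofRealCLM.hasDerivAt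
      simpa using (h1.smul_const v).const_add x
    have h2 : HasDerivAt (fun s : ℝ => f (x + (s : ℂ) • v)) (fderiv ℂ f x v) 0 := by
      have h3 : HasFDerivAt f ((fderiv ℂ f x).restrictScalars ℝ) (x + ((0 : ℝ) : ℂ) • v) := by
        simpa using hf.hasFDerivAt.restrictScalars ℝ
      exact h3.comp_hasDerivAt (0 : ℝ) hline
    have h4 : HasDerivAt (fun s : ℝ => (f (x + (s : ℂ) • v)).im) (fderiv ℂ f x v).im 0 :=
      Complex.imCLM.hasFDerivAt.comp_hasDerivAt (0 : ℝ) h2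
    have h5 : (fun s : ℝ => (f (x + (s : ℂ) • v)).im) =ᶠ[𝓝 0] fun _ => 0 := by
      have h6 : Filter.Tendsto (fun s : ℝ => x + (s : ℂ) • v) (𝓝 0) (𝓝 x) := by
        simpa using hline.continuousAt.tendsto
      filter_upwards [h6.eventually hre] with s hs using hs (hx.add (hv.smul s))
    rw [← h4.deriv, h5.deriv_eq, deriv_const]
  have h1 := key _ (isRealCoeff_dir_add hm I 1)
  have h2 := key _ (isRealCoeff_dir_add hm I Complex.I)
  rw [map_add, map_smul, map_smul] at h1 h2
  have h3 : (-1 : ℂ) ^ m * conj Complex.I * fderiv ℂ f x (dir I (-m)) =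
    -Complex.I * ((-1 : ℂ) ^ m * fderiv ℂ f x (dir I (-m))) := by rw [Complex.conj_I]; ring
  rw [smul_eq_mul, smul_eq_mul, h3] at h2
  rw [smul_eq_mul, smul_eq_mul, map_one, mul_one, one_mul] at h1
  generalize (-1 : ℂ) ^ m * fderiv ℂ f x (dir I (-m)) = b at *
  simp at h1 h2
  apply Complex.ext <;> simp <;> linarith

theorem conj_d1 {B : Type*} [DecidableEq ι] {H : B → FunctionElement ι} {L : Coeff ι j → ℂ}
    {x : Coeff ι j} (h : IsContourPotentialAt H L x) (hx : IsRealCoeff x)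
    (hre : ∀ᶠ y in 𝓝 x, IsRealCoeff y → (L y).im = 0) (I : ι) {m : ℤ}
    (hm : m ∈ Finset.Icc (-(j : ℤ)) j) :
    conj (d1 L I m x) = (-1) ^ m * d1 L I (-m) x :=
  conj_fderiv_dir h.differentiableAt hx hre I hm

theorem conj_d2 {B : Type*} [DecidableEq ι] {H : B → FunctionElement ι} {L : Coeff ι j → ℂ}
    {x : Coeff ι j} (h : IsContourPotentialAt H L x) (hx : IsRealCoeff x)
    (hre : ∀ᶠ y in 𝓝 x, IsRealCoeff y → (L y).im = 0) (I J : ι) {m n : ℤ}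
    (hm : m ∈ Finset.Icc (-(j : ℤ)) j) (hn : n ∈ Finset.Icc (-(j : ℤ)) j) :
    conj (d2 L I m J n x) = (-1) ^ (m + n) * d2 L I (-m) J (-n) x := by
  have hd1 := (h.d1 J hn).differentiableAt
  have hd2 := (h.d1 J (neg_mem_Icc hn)).differentiableAt
  have hev : ∀ᶠ y in 𝓝 x, IsRealCoeff y →
      conj (d1 L J n y) = (-1) ^ n * d1 L J (-n) y := by
    filter_upwards [h.eventually, hre.eventually_nhds] with y h1 h2 h3
    exact conj_d1 h1 h3 h2 J hn
  -- A single `L_{x_n}` is not real at real points, but `a L_{x_n} + ā (-1)^n L_{x_{-n}}` is, being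
  -- a number plus its conjugate. The choices `a = 1` and `a = i` then separate the two terms.
  have key (a : ℂ) : conj (a * d2 L I m J n x + conj a * ((-1) ^ n * d2 L I m J (-n) x)) =
      (-1) ^ m * (a * d2 L I (-m) J n x + conj a * ((-1) ^ n * d2 L I (-m) J (-n) x)) := by
    have hfd : HasFDerivAt (fun y => a * d1 L J n y + conj a * ((-1) ^ n * d1 L J (-n) y))
        (a • fderiv ℂ (fun y => d1 L J n y) x +
          conj a • (-1 : ℂ) ^ n • fderiv ℂ (fun y => d1 L J (-n) y) x) x :=
      (hd1.hasFDerivAt.const_mul a).add ((hd2.hasFDerivAt.const_mul _).const_mul _)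
    have := conj_fderiv_dir hfd.differentiableAt hx (by
      filter_upwards [hev] with y h1 h2
      rw [← h1 h2, ← map_mul, Complex.add_conj, Complex.ofReal_im]) I hm
    rw [hfd.fderiv] at this
    exact this
  have k1 := key 1
  have k2 := key Complex.I
  simp only [map_add, map_mul, map_one, one_mul, Complex.conj_I, map_neg, conj_neg_one_zpow] at k1 k2
  rw [zpow_add₀ (by norm_num)]
  have e : (2 : ℂ) * Complex.I ≠ 0 := by simp
  apply mul_left_cancel₀ e
  linear_combination Complex.I * k1 - k2

/-- The map `m ↦ -m` on the range `1-j, …, j-1`. -/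
def negInner (j : ℕ) : Inner j ≃ Inner j where
  toFun m := ⟨-m, by have := Finset.mem_Icc.1 m.2; rw [Finset.mem_Icc]; omega⟩
  invFun m := ⟨-m, by have := Finset.mem_Icc.1 m.2; rw [Finset.mem_Icc]; omega⟩
  left_inv m := Subtype.ext (neg_neg _)
  right_inv m := Subtype.ext (neg_neg _)

/-- The hypothesis says that the Hankel matrix is fixed by conjugation combined with the signed
reversal `m ↦ -m`. This operation respects products and the identity, so the inverse is fixed too.
-/
theorem conj_hankel_inv [DecidableEq ι] {h : ℤ → ι → ι → ℂ}
    (hc : ∀ m ∈ Finset.Icc (-(j : ℤ)) j, ∀ n ∈ Finset.Icc (-(j : ℤ)) j, ∀ I J,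
      conj (h (m + n) I J) = (-1) ^ (m + n) * h (-m + -n) I J)
    (hdet : IsUnit (hankel j h).det) (a b : ι × Inner j) :
    conj ((hankel j h)⁻¹ a b) = (-1) ^ ((a.2 : ℤ) + b.2) *
      (hankel j h)⁻¹ (a.1, negInner j a.2) (b.1, negInner j b.2) := by
  set N := (hankel j h)⁻¹ with hN
  have hMN : hankel j h * N = 1 := Matrix.mul_nonsing_inv _ hdet
  have hsub (m : Inner j) : (m : ℤ) ∈ Finset.Icc (-(j : ℤ)) j := by
    have := Finset.mem_Icc.1 m.2; rw [Finset.mem_Icc]; omega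
  set e : ι × Inner j ≃ ι × Inner j := (Equiv.refl ι).prodCongr (negInner j)
  have : hankel j h * Matrix.of (fun a b => (-1) ^ ((a.2 : ℤ) + b.2) * conj (N (e a) (e b))) = 1 := by
    ext a b
    rw [Matrix.mul_apply]
    have h1 : ∀ c, hankel j h a c * Matrix.of
        (fun a b => (-1) ^ ((a.2 : ℤ) + b.2) * conj (N (e a) (e b))) c b =
        (-1) ^ ((a.2 : ℤ) + b.2) * conj (hankel j h (e a) (e c) * N (e c) (e b)) := by
      intro c
      have h2 : conj (hankel j h (e a) (e c)) =
          (-1) ^ ((a.2 : ℤ) + c.2) * hankel j h a c := by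
        have := hc _ (hsub (negInner j a.2)) _ (hsub (negInner j c.2)) a.1 c.1
        simp only [hankel, Matrix.of_apply]
        refine this.trans ?_
        simp only [negInner, Equiv.coe_fn_mk, neg_neg]
        rw [← neg_add, neg_one_zpow_neg]
      rw [map_mul, h2, Matrix.of_apply, zpow_add₀ (by norm_num), zpow_add₀ (by norm_num),
        zpow_add₀ (by norm_num)]
      linear_combination (-(-1 : ℂ) ^ (b.2 : ℤ) * (-1) ^ (c.2 : ℤ) * hankel j h a c *
        conj (N (e c) (e b))) * neg_one_zpow_mul_self (a.2 : ℤ)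
    simp only [h1]
    rw [← Finset.mul_sum, ← map_sum, e.sum_comp (fun c => hankel j h (e a) c * N c (e b)),
      ← Matrix.mul_apply, hMN, Matrix.one_apply, Matrix.one_apply]
    by_cases hab : a = b
    · subst hab
      simp [zpow_add₀ (show (-1 : ℂ) ≠ 0 by norm_num), neg_one_zpow_mul_self]
    · simp [hab]
  have h3 := Matrix.inv_eq_right_inv this
  rw [← hN] at h3
  conv_lhs => rw [h3]
  rw [Matrix.of_apply, map_mul, Complex.conj_conj, conj_neg_one_zpow]
  rfl

end Reality

/-! ### Hermiticity of `Φ`, the conjugate of `A`, and the symmetry of `A`. -/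

section Matrices

open Matrix

variable {ι : Type*} [Fintype ι] [DecidableEq ι] {j : ℕ}

theorem coe_inner_mem (m : Inner j) : (m : ℤ) ∈ Finset.Icc (-(j : ℤ)) j := by
  have := Finset.mem_Icc.1 m.2; rw [Finset.mem_Icc]; omega

theorem self_mem_Icc (j : ℕ) : (j : ℤ) ∈ Finset.Icc (-(j : ℤ)) j := by rw [Finset.mem_Icc]; omega

/-- Reversal exchanges the indices `j-1` and `1-j`, whose sum is zero, so no sign appears; symmetry
of the inverse restores their order. -/
theorem block_hankel_inv_isHermitian (hj : 1 ≤ j) {h : ℤ → ι → ι → ℂ}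
    (hs : ∀ k I J, h k I J = h k J I)
    (hc : ∀ m ∈ Finset.Icc (-(j : ℤ)) j, ∀ n ∈ Finset.Icc (-(j : ℤ)) j, ∀ I J,
      conj (h (m + n) I J) = (-1) ^ (m + n) * h (-m + -n) I J)
    (hdet : IsUnit (hankel j h).det) :
    (block (hankel j h)⁻¹ (top hj) (bot hj)).IsHermitian := by
  ext I J
  have h1 := conj_hankel_inv hc hdet (J, top hj) (I, bot hj)
  have e1 : negInner j (top hj) = bot hj := Subtype.ext (by simp [negInner, top, bot])
  have e2 : negInner j (bot hj) = top hj := Subtype.ext (by simp [negInner, top, bot])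
  rw [e1, e2] at h1
  have e3 : (((J, top hj) : ι × Inner j).2 : ℤ) + (((I, bot hj) : ι × Inner j).2 : ℤ) = 0 := by
    simp [top, bot]
  rw [e3, zpow_zero, one_mul] at h1
  refine h1.trans ?_
  exact congrFun (congrFun (hankel_inv_isSymm hs).eq _) _

/-- The minus sign is `(-1)^{j+a} (-1)^{a+1-j}`, from the row and from the inverse. -/
theorem conjTranspose_hankelRow_mul_blockCol (hj : 1 ≤ j) {h : ℤ → ι → ι → ℂ}
    (hc : ∀ m ∈ Finset.Icc (-(j : ℤ)) j, ∀ n ∈ Finset.Icc (-(j : ℤ)) j, ∀ I J,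
      conj (h (m + n) I J) = (-1) ^ (m + n) * h (-m + -n) I J)
    (hdet : IsUnit (hankel j h).det) :
    (hankelRow j h j * blockCol (hankel j h)⁻¹ (bot hj))ᴴ =
      -((blockCol (hankel j h)⁻¹ (top hj))ᵀ * (hankelRow j h (-j))ᵀ) := by
  set N := (hankel j h)⁻¹ with hN
  set e : ι × Inner j ≃ ι × Inner j := (Equiv.refl ι).prodCongr (negInner j)
  have e2 : negInner j (bot hj) = top hj := Subtype.ext (by simp [negInner, top, bot])
  ext J I
  rw [conjTranspose_apply, Matrix.neg_apply, mul_apply, mul_apply,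
    ← e.sum_comp (fun a => (blockCol N (top hj))ᵀ J a * (hankelRow j h (-j))ᵀ a I), ← Finset.sum_neg_distrib, star_sum]
  refine Finset.sum_congr rfl fun a _ => ?_
  have h1 := conj_hankel_inv hc hdet a (J, bot hj)
  have h2 := hc j (self_mem_Icc j) a.2 (coe_inner_mem a.2) I a.1
  rw [e2] at h1
  change conj (h (j + a.2) I a.1 * N a (J, bot hj)) =
    -(N (a.1, negInner j a.2) (J, top hj) * h (-j + -a.2) I a.1)
  rw [map_mul, h2, h1, zpow_add₀ (by norm_num), zpow_add₀ (by norm_num)]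
  have h3 : (-1 : ℂ) ^ (((J, bot hj) : ι × Inner j).2 : ℤ) = - (-1) ^ (j : ℤ) := by
    change (-1 : ℂ) ^ (1 - (j : ℤ)) = _
    rw [sub_eq_add_neg, zpow_add₀ (by norm_num), neg_one_zpow_neg]; simp
  rw [h3]
  linear_combination (-(h (-j + -a.2) I a.1 * N (a.1, negInner j a.2) (J, top hj)) *
    ((-1) ^ (a.2 : ℤ) * (-1) ^ (a.2 : ℤ))) * neg_one_zpow_mul_self (j : ℤ) -
    h (-j + -a.2) I a.1 * N (a.1, negInner j a.2) (J, top hj) * neg_one_zpow_mul_self (a.2 : ℤ)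

variable {L : Coeff ι j → ℂ} {x : Coeff ι j} {h : ℤ → ι → ι → ℂ}

theorem hessInner_eq_hankel
    (hd : ∀ m ∈ Finset.Icc (-(j : ℤ)) j, ∀ n ∈ Finset.Icc (-(j : ℤ)) j, ∀ I J,
        d2 L I m J n x = h (m + n) I J) : hessInner L x = hankel j h := by
  ext a b
  exact hd _ (coe_inner_mem _) _ (coe_inner_mem _) _ _

theorem AMat_eq (hj : 1 ≤ j)
    (hd : ∀ m ∈ Finset.Icc (-(j : ℤ)) j, ∀ n ∈ Finset.Icc (-(j : ℤ)) j, ∀ I J,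
        d2 L I m J n x = h (m + n) I J) :
    AMat hj L x = (-Complex.I) • (hankelRow j h j * blockCol (hankel j h)⁻¹ (bot hj) *
      (block (hankel j h)⁻¹ (top hj) (bot hj))⁻¹) := by
  ext I J
  have h1 : PhiInv hj L x = (block (hankel j h)⁻¹ (top hj) (bot hj))⁻¹ := by
    rw [PhiInv, ← hessInner_eq_hankel hd]; rfl
  rw [AMat, Matrix.smul_apply, smul_eq_mul, h1, hessInner_eq_hankel hd, mul_apply,
    Finset.sum_comm]
  simp_rw [mul_apply, Finset.sum_mul]
  congr 1
  refine Finset.sum_congr rfl fun P _ => Finset.sum_congr rfl fun a _ => ?_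
  rw [hd _ (self_mem_Icc j) _ (coe_inner_mem _)]
  rfl

theorem conj_AMat_eq (hj : 1 ≤ j) (hs : ∀ k I J, h k I J = h k J I)
    (hd : ∀ m ∈ Finset.Icc (-(j : ℤ)) j, ∀ n ∈ Finset.Icc (-(j : ℤ)) j, ∀ I J,
        d2 L I m J n x = h (m + n) I J)
    (hc : ∀ m ∈ Finset.Icc (-(j : ℤ)) j, ∀ n ∈ Finset.Icc (-(j : ℤ)) j, ∀ I J,
      conj (h (m + n) I J) = (-1) ^ (m + n) * h (-m + -n) I J)
    (hdet : IsUnit (hankel j h).det) :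
    (AMat hj L x)ᴴ = (-Complex.I) • ((block (hankel j h)⁻¹ (top hj) (bot hj))⁻¹ *
      ((blockCol (hankel j h)⁻¹ (top hj))ᵀ * (hankelRow j h (-j))ᵀ)) := by
  rw [AMat_eq hj hd, conjTranspose_smul, conjTranspose_mul,
    conjTranspose_hankelRow_mul_blockCol hj hc hdet,
    (block_hankel_inv_isHermitian hj hs hc hdet).inv.eq, Matrix.mul_neg]
  simp

/-- With `A = -i B Φ⁻¹`, symmetry of `Φᵀ B` means `Φᵀ B = Bᵀ Φ`, which is symmetry of `B Φ⁻¹`. -/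
theorem AMat_isSymm (hj : 1 ≤ j) (hs : ∀ k I J, h k I J = h k J I)
    (hd : ∀ m ∈ Finset.Icc (-(j : ℤ)) j, ∀ n ∈ Finset.Icc (-(j : ℤ)) j, ∀ I J,
        d2 L I m J n x = h (m + n) I J)
    (hdet : IsUnit (hankel j h).det)
    (hPhi : IsUnit (block (hankel j h)⁻¹ (top hj) (bot hj)).det) :
    (AMat hj L x).IsSymm := by
  rw [AMat_eq hj hd]
  have key := transpose_block_mul_hankelRow_isSymm hj hs hdet
  set Φ := block (hankel j h)⁻¹ (top hj) (bot hj)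
  set B := hankelRow j h j * blockCol (hankel j h)⁻¹ (bot hj)
  have hPhi' : IsUnit Φᵀ.det := by rwa [det_transpose]
  rw [IsSymm, transpose_mul, transpose_transpose] at key
  rw [IsSymm, transpose_smul, transpose_mul, transpose_nonsing_inv]
  congr 1
  calc Φᵀ⁻¹ * Bᵀ = Φᵀ⁻¹ * (Bᵀ * Φ) * Φ⁻¹ := by
        rw [Matrix.mul_assoc, Matrix.mul_assoc, mul_nonsing_inv _ hPhi, Matrix.mul_one]
    _ = B * Φ⁻¹ := by rw [key, ← Matrix.mul_assoc, nonsing_inv_mul _ hPhi', Matrix.one_mul]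

end Matrices

/-! ### First-order consequences of the equations of the construction. -/

section Differentials

variable {ι B : Type*} [Fintype ι] [DecidableEq ι] {j : ℕ} {H : B → FunctionElement ι}
  {L : Coeff ι j → ℂ} {U : Set (Hol ι)} {x : Hol ι → Coeff ι j} {p : ι → ℤ → Hol ι → ℂ}
  {q : Hol ι}

omit [DecidableEq ι] in
theorem hasFDerivAt_coef (hx : DifferentiableAt ℝ x q) (I : ι) (m : ℤ) :
    ∃ f : Hol ι →L[ℝ] ℂ, HasFDerivAt (fun r => coef (x r) I m) f q ∧
      ∀ X, f X = coef (fderiv ℝ x q X) I m := by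
  by_cases hm : m ∈ Finset.Icc (-(j : ℤ)) j
  · refine ⟨_, ((hasFDerivAt_pi'.1 hx.hasFDerivAt (I, ⟨m, hm⟩)).congr_of_eventuallyEq
      (Filter.Eventually.of_forall fun r => coef_of_mem hm)), fun X => ?_⟩
    rw [coef_of_mem hm]; rfl
  · refine ⟨0, (hasFDerivAt_const (0 : ℂ) q).congr_of_eventuallyEq
      (Filter.Eventually.of_forall fun r => dif_neg hm), fun X => ?_⟩
    rw [coef, dif_neg hm]; rfl

omit [DecidableEq ι] in
theorem fderiv_coef (hx : DifferentiableAt ℝ x q) (I : ι) (m : ℤ) (X : Hol ι) :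
    fderiv ℝ (fun r => coef (x r) I m) q X = coef (fderiv ℝ x q X) I m := by
  obtain ⟨f, hf, h⟩ := hasFDerivAt_coef hx I m
  rw [hf.fderiv, h]

theorem sum_Idx (hj : 1 ≤ j) (f : ℤ → ℂ) :
    ∑ n : Idx j, f n = f j + ∑ n : Inner j, f n + f (-j) := by
  rw [Finset.sum_coe_sort (Finset.Icc (-(j : ℤ)) j) f,
    Finset.sum_coe_sort (Finset.Icc (1 - (j : ℤ)) (j - 1)) f]
  have e : Finset.Icc (1 - (j : ℤ)) (j - 1) =
      ((Finset.Icc (-(j : ℤ)) j).erase j).erase (-j) := by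
    ext n
    simp only [Finset.mem_Icc, Finset.mem_erase]
    omega
  rw [e, add_assoc, Finset.sum_erase_add _ f (by
    simp only [Finset.mem_Icc, Finset.mem_erase]; omega),
    Finset.add_sum_erase _ f (self_mem_Icc j)]

theorem map_coeff_eq_sum (hj : 1 ≤ j) (T : Coeff ι j →L[ℂ] ℂ) (v : Coeff ι j) :
    T v = ∑ K, coef v K j * T (dir K j) +
      ∑ a : ι × Inner j, coef v a.1 a.2 * T (dir a.1 a.2) +
      ∑ K, coef v K (-j) * T (dir K (-j)) := by
  have h1 : v = ∑ k : ι × Idx j, v k • dir k.1 k.2 := by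
    ext k
    rw [Finset.sum_apply, Finset.sum_eq_single k]
    · simp [dir]
    · intro b _ hb
      rw [Pi.smul_apply, dir, if_neg, smul_zero]
      exact fun h => hb (Prod.ext h.1 (Subtype.ext h.2)).symm
    · simp
  conv_lhs => rw [h1]
  rw [map_sum, Fintype.sum_prod_type, Fintype.sum_prod_type, ← Finset.sum_add_distrib,
    ← Finset.sum_add_distrib]
  refine Finset.sum_congr rfl fun K _ => ?_
  rw [← sum_Idx hj (fun n => coef v K n * T (dir K n))]
  refine Finset.sum_congr rfl fun n _ => ?_
  rw [coef_of_mem n.2, map_smul, smul_eq_mul]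

theorem hasFDerivAt_d1 (hL : IsContourPotentialAt H L (x q)) (hx : DifferentiableAt ℝ x q)
    (I : ι) {m : ℤ} (hm : m ∈ Finset.Icc (-(j : ℤ)) j) :
    HasFDerivAt (fun r => d1 L I m (x r))
      (((fderiv ℂ (fun y => d1 L I m y) (x q)).restrictScalars ℝ).comp (fderiv ℝ x q)) q :=
  HasFDerivAt.comp q ((hL.d1 I hm).differentiableAt.hasFDerivAt.restrictScalars ℝ) hx.hasFDerivAt

omit [Fintype ι] [DecidableEq ι] in
theorem IsRealCoeff.coef_neg {y : Coeff ι j} (hy : IsRealCoeff y) (I : ι) (m : ℤ) :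
    coef y I (-m) = (-1) ^ m * conj (coef y I m) := by
  have := hy I (-m)
  rwa [neg_neg, neg_one_zpow_neg, eq_comm] at this

theorem IsGLTSolution.coef_fderiv_top (hsol : IsGLTSolution L U x p) (hU : U ∈ 𝓝 q)
    (hx : DifferentiableAt ℝ x q) (I : ι) (X : Hol ι) : coef (fderiv ℝ x q X) I j = X.1 I := by
  rw [← fderiv_coef hx]
  have : (fun r => coef (x r) I j) =ᶠ[𝓝 q] dz I := by
    filter_upwards [hU] with r hr using hsol.leading_x r hr I
  rw [this.fderiv_eq, (dz I).fderiv]; rfl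

/-- The reality condition is inherited by the derivative. -/
theorem IsGLTSolution.isRealCoeff_fderiv (hsol : IsGLTSolution L U x p) (hU : U ∈ 𝓝 q)
    (hx : DifferentiableAt ℝ x q) (X : Hol ι) : IsRealCoeff (fderiv ℝ x q X) := by
  intro I m
  obtain ⟨f, hf, hfX⟩ := hasFDerivAt_coef hx I (-m)
  have h1 := ((Complex.conjCLE.toContinuousLinearMap.hasFDerivAt.comp q hf).const_mul
    ((-1 : ℂ) ^ m))
  have h2 : (fun r => coef (x r) I m) =ᶠ[𝓝 q] fun r => (-1 : ℂ) ^ m * conj (coef (x r) I (-m)) := by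
    filter_upwards [hU] with r hr using (hsol.real r hr I m).symm
  rw [← fderiv_coef hx I m, (h1.congr_of_eventuallyEq h2).fderiv, ← hfX]
  rfl

/-- Two separate conditionals are needed: for `j = 1` both apply at `m = 0`, and the terms add up to
`2 Im u_I`. -/
theorem IsGLTSolution.d1_eq (hsol : IsGLTSolution L U x p) (hq : q ∈ U) (I : ι) {m : ℤ}
    (hm : m ∈ Finset.Icc (1 - (j : ℤ)) (j - 1)) :
    d1 L I m (x q) = -Complex.I * (if m = j - 1 then q.2 I else 0) +
      Complex.I * (-1) ^ m * (if m = 1 - j then conj (q.2 I) else 0) := by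
  have hm' := Finset.mem_Icc.1 hm
  have h1 := hsol.matching q hq I (-m) (by rw [Finset.mem_Icc]; omega)
  rw [neg_neg, neg_one_zpow_neg] at h1
  have h2 : p I (-m) q = if m = j - 1 then q.2 I else 0 := by
    split_ifs with h
    · rw [← hsol.leading_p q hq I]; congr 1; omega
    · exact hsol.p_eq_zero q hq I _ (by omega)
  have h3 : conj (p I m q) = if m = 1 - j then conj (q.2 I) else 0 := by
    split_ifs with h
    · rw [← hsol.leading_p q hq I, h]
    · rw [hsol.p_eq_zero q hq I _ (by omega), map_zero]
  rw [← h2, ← h3]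
  linear_combination -Complex.I * h1 + d1 L I m (x q) * Complex.I_mul_I

theorem IsGLTSolution.p_neg_eq (hsol : IsGLTSolution L U x p) (hj : 1 ≤ j) (hq : q ∈ U) (I : ι) :
    p I (-j) q = Complex.I * d1 L I j (x q) := by
  have h1 := hsol.matching q hq I (-j) (neg_mem_Icc (self_mem_Icc j))
  -- `p_{I,j}` vanishes since `j > 1 - j`; this uses `j ≥ 1`.
  rw [neg_neg, hsol.p_eq_zero q hq I j (by omega), map_zero, mul_zero] at h1
  linear_combination -h1

theorem IsGLTSolution.conj_d1_neg (hsol : IsGLTSolution L U x p) (hj : 1 ≤ j) (hq : q ∈ U) (I : ι) :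
    conj (d1 L I (-j) (x q)) = (-1) ^ j * d1 L I j (x q) := by
  have h1 := hsol.matching q hq I j (self_mem_Icc j)
  rw [hsol.p_eq_zero q hq I j (by omega), hsol.p_neg_eq hj hq, zero_sub] at h1
  have h2 := congrArg conj h1
  simp only [map_mul, map_neg, Complex.conj_conj, Complex.conj_I, zpow_natCast, map_pow, map_one] at h2
  linear_combination Complex.I * h2 + (conj (d1 L I (-j) (x q)) - (-1) ^ j * d1 L I j (x q)) *
     Complex.I_mul_I

end Differentials

/-! ### Solving the linearized equations for `dx` and `dp`. -/

section PointwiseDifferentials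

open Matrix

variable {ι B : Type*} [Fintype ι] [DecidableEq ι] {j : ℕ} {H : B → FunctionElement ι}
  {L : Coeff ι j → ℂ} {U : Set (Hol ι)} {x : Hol ι → Coeff ι j} {p : ι → ℤ → Hol ι → ℂ}
  {q : Hol ι} {h : ℤ → ι → ι → ℂ}

/-- The coefficients with `1-j ≤ m ≤ j-1`. -/
noncomputable def innerCoef (v : Coeff ι j) : ι × Inner j → ℂ := fun a => coef v a.1 a.2

theorem neg_one_pow_eq_neg (hj : 1 ≤ j) : (-1 : ℂ) ^ j = -(-1) ^ (j - 1) := by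
  obtain ⟨k, rfl⟩ := Nat.exists_eq_add_of_le' hj
  rw [Nat.add_sub_cancel, pow_succ]; ring

theorem neg_one_zpow_one_sub (hj : 1 ≤ j) : (-1 : ℂ) ^ (1 - (j : ℤ)) = (-1) ^ (j - 1) := by
  rw [← neg_sub, neg_one_zpow_neg, ← zpow_natCast]
  congr 1; omega

/-- The chain rule for `L_{x^I_m}`. -/
theorem IsGLTSolution.fderiv_d1 (hsol : IsGLTSolution L U x p) (hj : 1 ≤ j) (hU : U ∈ 𝓝 q)
    (hx : DifferentiableAt ℝ x q) (hL : IsContourPotentialAt H L (x q))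
    (hs : ∀ k I J, h k I J = h k J I)
    (hd : ∀ m ∈ Finset.Icc (-(j : ℤ)) j, ∀ n ∈ Finset.Icc (-(j : ℤ)) j, ∀ I J,
        d2 L I m J n (x q) = h (m + n) I J)
    (I : ι) {m : ℤ} (hm : m ∈ Finset.Icc (-(j : ℤ)) j) (X : Hol ι) :
    fderiv ℝ (fun r => d1 L I m (x r)) q X =
      (of (h (j + m)) *ᵥ X.1 + hankelRow j h m *ᵥ innerCoef (fderiv ℝ x q X) -
        (-1 : ℂ) ^ (j - 1) • of (h (-j + m)) *ᵥ star X.1) I := by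
  rw [(hasFDerivAt_d1 hL hx I hm).fderiv]
  change fderiv ℂ (fun y => d1 L I m y) (x q) (fderiv ℝ x q X) = _
  have e (K : ι) (n : ℤ) (hn : n ∈ Finset.Icc (-(j : ℤ)) j) :
      fderiv ℂ (fun y => d1 L I m y) (x q) (dir K n) = h (n + m) I K := by
    rw [hs]; exact hd n hn m hm K I
  -- The extreme coefficients are known: `dx_j = dz` and `dx_{-j} = (-1)^j dz̄`. Only the inner
  -- differentials remain as unknowns.
  rw [map_coeff_eq_sum hj]
  simp only [e _ _ (coe_inner_mem _), e _ _ (self_mem_Icc j), e _ _ (neg_mem_Icc (self_mem_Icc j)),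
    (hsol.isRealCoeff_fderiv hU hx X).coef_neg, hsol.coef_fderiv_top hU hx]
  rw [Pi.sub_apply, Pi.add_apply, Pi.smul_apply, zpow_natCast, neg_one_pow_eq_neg hj]
  refine Eq.trans ?_ (sub_eq_add_neg _ _).symm
  simp only [mulVec, dotProduct, smul_eq_mul, Finset.mul_sum, ← Finset.sum_neg_distrib]
  congr 1
  · congr 1
    · exact Finset.sum_congr rfl fun K _ => mul_comm _ _
    · refine Finset.sum_congr rfl fun a _ => ?_
      rw [mul_comm, add_comm]; rfl
  · refine Finset.sum_congr rfl fun K _ => ?_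
    simp only [of_apply, Pi.star_apply, starRingEnd_apply]; ring

/-- The differentials of the coefficients `x^I_a` in terms of those of the coordinates. -/
theorem IsGLTSolution.innerCoef_fderiv (hsol : IsGLTSolution L U x p) (hj : 1 ≤ j) (hU : U ∈ 𝓝 q)
    (hx : DifferentiableAt ℝ x q) (hL : IsContourPotentialAt H L (x q))
    (hs : ∀ k I J, h k I J = h k J I)
    (hd : ∀ m ∈ Finset.Icc (-(j : ℤ)) j, ∀ n ∈ Finset.Icc (-(j : ℤ)) j, ∀ I J,
        d2 L I m J n (x q) = h (m + n) I J)
    (hdet : IsUnit (hankel j h).det) (X : Hol ι) :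
    innerCoef (fderiv ℝ x q X) =
      (-Complex.I) • blockCol (hankel j h)⁻¹ (top hj) *ᵥ X.2 +
      (Complex.I * (-1) ^ (j - 1)) • blockCol (hankel j h)⁻¹ (bot hj) *ᵥ star X.2 -
      ((hankel j h)⁻¹ * (hankelRow j h j)ᵀ) *ᵥ X.1 +
      (-1 : ℂ) ^ (j - 1) • ((hankel j h)⁻¹ * (hankelRow j h (-j))ᵀ) *ᵥ star X.1 := by
  set N := (hankel j h)⁻¹ with hN
  have hNM : N * hankel j h = 1 := nonsing_inv_mul _ hdet
  -- The differential along `X` of the right-hand sides of `d1_eq`.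
  set ψ : ι × Inner j → ℂ := (-Complex.I) • (fun a => if a.2 = top hj then X.2 a.1 else 0) +
    (Complex.I * (-1) ^ (j - 1)) • (fun a => if a.2 = bot hj then star X.2 a.1 else 0) with hψ
  have h1 : (hankelRow j h j)ᵀ *ᵥ X.1 + hankel j h *ᵥ innerCoef (fderiv ℝ x q X) -
      (-1 : ℂ) ^ (j - 1) • (hankelRow j h (-j))ᵀ *ᵥ star X.1 = ψ := by
    ext ⟨I, m⟩
    have h2 := hsol.fderiv_d1 hj hU hx hL hs hd I (coe_inner_mem m) X
    have h3 : HasFDerivAt (fun r : Hol ι => -Complex.I * (if m = top hj then r.2 I else 0) +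
        (Complex.I * (-1) ^ (j - 1)) * (if m = bot hj then conj (r.2 I) else 0))
        ((-Complex.I) • (if m = top hj then du I else 0) +
          (Complex.I * (-1) ^ (j - 1)) • (if m = bot hj then conjForm (du I) else 0)) q := by
      refine HasFDerivAt.add (HasFDerivAt.const_mul ?_ _) (HasFDerivAt.const_mul ?_ _)
      · split_ifs
        · exact (du I).hasFDerivAt
        · exact hasFDerivAt_const _ _
      · split_ifs
        · exact (conjForm (du I)).hasFDerivAt
        · exact hasFDerivAt_const _ _
    have h4 : (fun r => d1 L I m (x r)) =ᶠ[𝓝 q]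
        fun r => -Complex.I * (if m = top hj then r.2 I else 0) +
        (Complex.I * (-1) ^ (j - 1)) * (if m = bot hj then conj (r.2 I) else 0) := by
      filter_upwards [hU] with r hr
      rw [hsol.d1_eq hr I m.2]
      simp only [Subtype.ext_iff, top, bot]
      by_cases hb : (m : ℤ) = 1 - j
      · rw [if_pos hb, hb, neg_one_zpow_one_sub hj]
      · rw [if_neg hb]; simp
    rw [(h3.congr_of_eventuallyEq h4).fderiv] at h2
    have h5 : ((-Complex.I) • (if m = top hj then du I else 0) +
          (Complex.I * (-1) ^ (j - 1)) • (if m = bot hj then conjForm (du I) else 0)) X =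
        ψ (I, m) := by
      change _ = -Complex.I * (if m = top hj then X.2 I else 0) +
        Complex.I * (-1) ^ (j - 1) * (if m = bot hj then conj (X.2 I) else 0)
      split_ifs <;> simp [du, conjForm]
    rw [← h5, h2]
    simp only [Pi.sub_apply, Pi.add_apply, Pi.smul_apply]
    congr 1
    · congr 1
      · refine Finset.sum_congr rfl fun K _ => ?_
        simp only [transpose_apply, hankelRow, of_apply]
        rw [hs]
    · congr 1
      refine Finset.sum_congr rfl fun K _ => ?_
      simp only [transpose_apply, hankelRow, of_apply]
      rw [hs]
  have h6 : N *ᵥ ψ = (-Complex.I) • blockCol N (top hj) *ᵥ X.2 +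
      (Complex.I * (-1) ^ (j - 1)) • blockCol N (bot hj) *ᵥ star X.2 := by
    have (n : Inner j) (v : ι → ℂ) :
        N *ᵥ (fun a => if a.2 = n then v a.1 else 0) = blockCol N n *ᵥ v := by
      ext a
      simp [mulVec, dotProduct, Fintype.sum_prod_type, blockCol]
    rw [hψ, mulVec_add, mulVec_smul, mulVec_smul, this, this]
  have h7 := congrArg (N *ᵥ ·) h1
  simp only [mulVec_sub, mulVec_add, mulVec_smul, mulVec_mulVec, hNM, one_mulVec, h6] at h7
  rw [← h7]
  abel

/-- The differential of `x^I_{j-1}`. -/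
theorem IsGLTSolution.fderiv_x_top (hsol : IsGLTSolution L U x p) (hj : 1 ≤ j) (hU : U ∈ 𝓝 q)
    (hx : DifferentiableAt ℝ x q) (hL : IsContourPotentialAt H L (x q))
    (hs : ∀ k I J, h k I J = h k J I)
    (hd : ∀ m ∈ Finset.Icc (-(j : ℤ)) j, ∀ n ∈ Finset.Icc (-(j : ℤ)) j, ∀ I J,
        d2 L I m J n (x q) = h (m + n) I J)
    (hdet : IsUnit (hankel j h).det) (X : Hol ι) :
    (fun I => fderiv ℝ (fun r => coef (x r) I (j - 1)) q X) =
      (-Complex.I) • block (hankel j h)⁻¹ (top hj) (top hj) *ᵥ X.2 +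
      (Complex.I * (-1) ^ (j - 1)) • block (hankel j h)⁻¹ (top hj) (bot hj) *ᵥ star X.2 -
      (hankelRow j h j * blockCol (hankel j h)⁻¹ (top hj))ᵀ *ᵥ X.1 +
      (-1 : ℂ) ^ (j - 1) •
        ((blockCol (hankel j h)⁻¹ (top hj))ᵀ * (hankelRow j h (-j))ᵀ) *ᵥ star X.1 := by
  ext I
  have h1 := congrFun (hsol.innerCoef_fderiv hj hU hx hL hs hd hdet X) (I, top hj)
  have e : (blockCol (hankel j h)⁻¹ (top hj))ᵀ =
      (hankel j h)⁻¹.submatrix (fun I => (I, top hj)) id := by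
    ext I a
    exact congrFun (congrFun (hankel_inv_isSymm hs).eq _) _
  rw [fderiv_coef hx, transpose_mul, e]
  exact h1

/-- The differential of `p_{I,-j}`. -/
theorem IsGLTSolution.fderiv_p (hsol : IsGLTSolution L U x p) (hj : 1 ≤ j) (hU : U ∈ 𝓝 q)
    (hx : DifferentiableAt ℝ x q) (hL : IsContourPotentialAt H L (x q))
    (hs : ∀ k I J, h k I J = h k J I)
    (hd : ∀ m ∈ Finset.Icc (-(j : ℤ)) j, ∀ n ∈ Finset.Icc (-(j : ℤ)) j, ∀ I J,
        d2 L I m J n (x q) = h (m + n) I J)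
    (hdet : IsUnit (hankel j h).det) (X : Hol ι) :
    (fun I => fderiv ℝ (fun r => p I (-j) r) q X) =
      (hankelRow j h j * blockCol (hankel j h)⁻¹ (top hj)) *ᵥ X.2 -
      (-1 : ℂ) ^ (j - 1) • (hankelRow j h j * blockCol (hankel j h)⁻¹ (bot hj)) *ᵥ star X.2 +
      Complex.I • (of (h (j + j)) - hankelRow j h j * (hankel j h)⁻¹ * (hankelRow j h j)ᵀ) *ᵥ X.1 -
      (Complex.I * (-1) ^ (j - 1)) •
        (of (h 0) - hankelRow j h j * (hankel j h)⁻¹ * (hankelRow j h (-j))ᵀ) *ᵥ star X.1 := by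
  have h1 (I : ι) : fderiv ℝ (fun r => p I (-j) r) q X =
      Complex.I * fderiv ℝ (fun r => d1 L I j (x r)) q X := by
    have h2 : (fun r => p I (-j) r) =ᶠ[𝓝 q] fun r => Complex.I * d1 L I j (x r) := by
      filter_upwards [hU] with r hr using hsol.p_neg_eq hj hr I
    rw [h2.fderiv_eq, fderiv_const_mul (hasFDerivAt_d1 hL hx I (self_mem_Icc j)).differentiableAt]
    rfl
  ext I
  rw [h1, hsol.fderiv_d1 hj hU hx hL hs hd I (self_mem_Icc j),
    hsol.innerCoef_fderiv hj hU hx hL hs hd hdet, neg_add_cancel]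
  simp only [mulVec_add, mulVec_sub, sub_mulVec, mulVec_smul, mulVec_mulVec, Matrix.mul_assoc,
    Pi.add_apply, Pi.sub_apply, Pi.smul_apply, smul_eq_mul]
  linear_combination (-((hankelRow j h j * blockCol (hankel j h)⁻¹ (top hj)) *ᵥ X.2) I +
    (-1) ^ (j - 1) * ((hankelRow j h j * blockCol (hankel j h)⁻¹ (bot hj)) *ᵥ star X.2) I) *
      Complex.I_mul_I

end PointwiseDifferentials

/-! ### Linear algebra in the coframe `(dz, θ)`: from Hermitian form to hyperkähler triple. -/

section HermitianForm

open Matrix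

variable {ι : Type*} [Fintype ι] {A Φ D : Matrix ι ι ℂ}

/-- The components of the forms `du_I + dz^P A_{PI}`. -/
def thetaVec (A : Matrix ι ι ℂ) (X : Hol ι) : ι → ℂ := X.2 + Aᵀ *ᵥ X.1

/-- The sesquilinear form with the coefficients `D` and `Φ` in the coframe `(dz, θ)`. -/
def hermForm (D Φ A : Matrix ι ι ℂ) (X Y : Hol ι) : ℂ :=
  X.1 ⬝ᵥ D *ᵥ star Y.1 + thetaVec A X ⬝ᵥ Φ *ᵥ star (thetaVec A Y)

theorem theta_apply (A : Matrix ι ι ℂ) (I : ι) (X : Hol ι) : theta A I X = thetaVec A X I := by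
  simp [theta, thetaVec, du, dz, mulVec, dotProduct]

theorem sum_mul_conjForm (M : Matrix ι ι ℂ) (α : ι → Hol ι →L[ℝ] ℂ) (X Y : Hol ι) :
    ∑ I, ∑ J, M I J * (α I X * conjForm (α J) Y) =
      (fun I => α I X) ⬝ᵥ M *ᵥ star (fun I => α I Y) := by
  simp only [dotProduct, mulVec, Finset.mul_sum]
  refine Finset.sum_congr rfl fun I _ => Finset.sum_congr rfl fun J _ => ?_
  change _ * (α I X * conj (α J Y)) = α I X * (_ * conj (α J Y))
  ring

theorem sum_wedge (D Φ A : Matrix ι ι ℂ) (X Y : Hol ι) :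
    (∑ I, ∑ J, D I J * wedge (dz I) (conjForm (dz J)) X Y) +
      ∑ I, ∑ J, Φ I J * wedge (theta A I) (conjForm (theta A J)) X Y =
    (hermForm D Φ A X Y - hermForm D Φ A Y X) / 2 := by
  have key (M : Matrix ι ι ℂ) (α : ι → Hol ι →L[ℝ] ℂ) :
      ∑ I, ∑ J, M I J * wedge (α I) (conjForm (α J)) X Y =
        ((fun I => α I X) ⬝ᵥ M *ᵥ star (fun I => α I Y) -
          (fun I => α I Y) ⬝ᵥ M *ᵥ star (fun I => α I X)) / 2 := by
    rw [← sum_mul_conjForm, ← sum_mul_conjForm]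
    simp only [wedge, Finset.sum_div, ← Finset.sum_sub_distrib]
    refine Finset.sum_congr rfl fun I _ => Finset.sum_congr rfl fun J _ => ?_
    ring
  rw [key, key]
  simp only [theta_apply, hermForm]
  change (X.1 ⬝ᵥ D *ᵥ star Y.1 - Y.1 ⬝ᵥ D *ᵥ star X.1) / 2 + _ = _
  ring

theorem sum_symProd (D Φ A : Matrix ι ι ℂ) (X Y : Hol ι) :
    (∑ I, ∑ J, D I J * symProd (dz I) (conjForm (dz J)) X Y) +
      ∑ I, ∑ J, Φ I J * symProd (theta A I) (conjForm (theta A J)) X Y =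
    (hermForm D Φ A X Y + hermForm D Φ A Y X) / 2 := by
  have key (M : Matrix ι ι ℂ) (α : ι → Hol ι →L[ℝ] ℂ) :
      ∑ I, ∑ J, M I J * symProd (α I) (conjForm (α J)) X Y =
        ((fun I => α I X) ⬝ᵥ M *ᵥ star (fun I => α I Y) +
          (fun I => α I Y) ⬝ᵥ M *ᵥ star (fun I => α I X)) / 2 := by
    rw [← sum_mul_conjForm, ← sum_mul_conjForm]
    simp only [symProd, Finset.sum_div, ← Finset.sum_add_distrib]
    refine Finset.sum_congr rfl fun I _ => Finset.sum_congr rfl fun J _ => ?_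
    ring
  rw [key, key]
  simp only [theta_apply, hermForm]
  change (X.1 ⬝ᵥ D *ᵥ star Y.1 + Y.1 ⬝ᵥ D *ᵥ star X.1) / 2 + _ = _
  ring

theorem transpose_mulVec_dotProduct (M : Matrix ι ι ℂ) (v w : ι → ℂ) :
    Mᵀ *ᵥ v ⬝ᵥ w = v ⬝ᵥ M *ᵥ w := by
  rw [mulVec_transpose, dotProduct_mulVec]

theorem conj_dotProduct (v w : ι → ℂ) : conj (v ⬝ᵥ w) = star v ⬝ᵥ star w := by
  simp [dotProduct]

theorem star_transpose_mulVec (M : Matrix ι ι ℂ) (w : ι → ℂ) :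
    star (Mᵀ *ᵥ w) = Mᴴ *ᵥ star w := by
  ext i
  simp [mulVec, dotProduct]

theorem conj_hermForm (hD : D.IsHermitian) (hΦ : Φ.IsHermitian) (X Y : Hol ι) :
    conj (hermForm D Φ A X Y) = hermForm D Φ A Y X := by
  have key {M : Matrix ι ι ℂ} (hM : M.IsHermitian) (v w : ι → ℂ) :
      conj (v ⬝ᵥ M *ᵥ star w) = w ⬝ᵥ M *ᵥ star v := by
    rw [← transpose_mulVec_dotProduct, conj_dotProduct, star_transpose_mulVec, hM.eq, star_star,
      dotProduct_comm]
  rw [hermForm, map_add, key hD, key hΦ]; rfl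

theorem thetaVec_I_smul (A : Matrix ι ι ℂ) (X : Hol ι) :
    thetaVec A (Complex.I • X) = Complex.I • thetaVec A X := by
  simp [thetaVec, mulVec_smul]

theorem hermForm_I_smul (X Y : Hol ι) :
    hermForm D Φ A X (Complex.I • Y) = -Complex.I * hermForm D Φ A X Y := by
  have (v : ι → ℂ) : star (Complex.I • v) = (-Complex.I) • star v := by
    rw [star_smul]; simp
  simp only [hermForm, thetaVec_I_smul, Prod.smul_fst, this, mulVec_smul, dotProduct_smul,
    smul_eq_mul]
  ring

/-- The expansion of `dp_{I,-j} ∧ dz^I + du_I ∧ dx^I_{j-1}` in the coframe `(dz, θ)`. -/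
theorem pairing_eq_hermForm {T K E : Matrix ι ι ℂ} (hT : T.IsSymm) (hK : K.IsSymm) (c : ℂ)
    {dx dp : Hol ι → ι → ℂ}
    (hdx : ∀ X, dx X = (-Complex.I) • T *ᵥ X.2 + (Complex.I * c) • Φ *ᵥ star X.2 - Eᵀ *ᵥ X.1 +
      (Complex.I * c) • (Φ * Aᴴ) *ᵥ star X.1)
    (hdp : ∀ X, dp X = E *ᵥ X.2 - (Complex.I * c) • (A * Φ) *ᵥ star X.2 + Complex.I • K *ᵥ X.1 -
      (Complex.I * c) • (D + A * Φ * Aᴴ) *ᵥ star X.1) (X Y : Hol ι) :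
    X.2 ⬝ᵥ dx Y - Y.2 ⬝ᵥ dx X + dp X ⬝ᵥ Y.1 - dp Y ⬝ᵥ X.1 =
      Complex.I * c * (hermForm D Φ A X Y - hermForm D Φ A Y X) := by
  have hsymm {M : Matrix ι ι ℂ} (hM : M.IsSymm) (v w : ι → ℂ) : v ⬝ᵥ M *ᵥ w = w ⬝ᵥ M *ᵥ v := by
    rw [← transpose_mulVec_dotProduct, hM.eq, dotProduct_comm]
  have hE (v w : ι → ℂ) : v ⬝ᵥ Eᵀ *ᵥ w = w ⬝ᵥ E *ᵥ v := by
    rw [dotProduct_comm, transpose_mulVec_dotProduct]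
  rw [dotProduct_comm (dp X), dotProduct_comm (dp Y)]
  simp only [hermForm, thetaVec, hdx, hdp, star_add, star_transpose_mulVec, add_mulVec, mulVec_add,
    dotProduct_add, dotProduct_sub, dotProduct_smul, add_dotProduct, transpose_mulVec_dotProduct,
    ← mulVec_mulVec, hE, smul_eq_mul]
  -- The (2,0) terms cancel: `du ∧ du` and `dz ∧ dz` by symmetry of `T` and `K`, and `du ∧ dz`
  -- because `dx` contains `-Eᵀ` where `dp` contains `E`.
  rw [hsymm hT X.2 Y.2, hsymm hK X.1 Y.1]
  ring

/-- The antilinear almost complex structure with `ω₃ = ω₁(I₂ ·, ·)`. -/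
def antilinearStructure (D Φ A : Matrix ι ι ℂ) (c : ℂ) : Hol ι →ₗ[ℝ] Hol ι where
  toFun X := ((Complex.I * c) • star (Φᵀ *ᵥ thetaVec A X),
    (-(Complex.I * c)) • star (Dᵀ *ᵥ X.1) -
      Aᵀ *ᵥ ((Complex.I * c) • star (Φᵀ *ᵥ thetaVec A X)))
  map_add' X Y := by
    have : thetaVec A (X + Y) = thetaVec A X + thetaVec A Y := by
      simp only [thetaVec, Prod.fst_add, Prod.snd_add, mulVec_add]; abel
    ext1
    · simp only [this, mulVec_add, star_add, smul_add, Prod.mk_add_mk]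
    · simp only [this, mulVec_add, star_add, smul_add, Prod.mk_add_mk, Prod.fst_add]; abel
  map_smul' r X := by
    have h1 : thetaVec A (r • X) = r • thetaVec A X := by
      simp only [thetaVec, Prod.smul_fst, Prod.smul_snd, mulVec_smul, smul_add]
    have h2 (v : ι → ℂ) : star (r • v) = r • star v := by rw [star_smul]; simp
    ext1
    · simp only [h1, mulVec_smul, h2, RingHom.id_apply, Prod.smul_mk]
      rw [smul_comm]
    · simp only [h1, mulVec_smul, h2, RingHom.id_apply, Prod.smul_mk, Prod.smul_fst, smul_sub]
      rw [smul_comm _ r, smul_comm _ r]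

theorem antilinearStructure_fst (D Φ A : Matrix ι ι ℂ) (c : ℂ) (X : Hol ι) :
    (antilinearStructure D Φ A c X).1 = (Complex.I * c) • star (Φᵀ *ᵥ thetaVec A X) := rfl

theorem thetaVec_antilinearStructure (D Φ A : Matrix ι ι ℂ) (c : ℂ) (X : Hol ι) :
    thetaVec A (antilinearStructure D Φ A c X) = (-(Complex.I * c)) • star (Dᵀ *ᵥ X.1) :=
  sub_add_cancel _ _

/-- The forms `dz, θ` are a coframe for every `A`, so vectors may be compared by their components in
it. -/
theorem ext_thetaVec {X Y : Hol ι} (h1 : X.1 = Y.1) (h2 : thetaVec A X = thetaVec A Y) : X = Y := by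
  refine Prod.ext h1 ?_
  rwa [thetaVec, thetaVec, h1, add_left_inj] at h2

theorem antilinearStructure_I_smul (D Φ A : Matrix ι ι ℂ) (c : ℂ) (X : Hol ι) :
    antilinearStructure D Φ A c (Complex.I • X) =
      -(Complex.I • antilinearStructure D Φ A c X) := by
  have hst (v : ι → ℂ) : star (Complex.I • v) = (-Complex.I) • star v := by
    rw [star_smul]; simp
  rw [← neg_smul, ← neg_smul_neg (-Complex.I), neg_neg, smul_neg, ← neg_smul]
  refine ext_thetaVec (A := A) ?_ ?_
  · simp only [antilinearStructure_fst, thetaVec_I_smul, Prod.smul_fst, mulVec_smul, hst]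
    rw [smul_comm]
  · have : thetaVec A ((-Complex.I) • antilinearStructure D Φ A c X) =
        (-Complex.I) • thetaVec A (antilinearStructure D Φ A c X) := by
      simp only [thetaVec, Prod.smul_fst, Prod.smul_snd, mulVec_smul, smul_add]
    rw [this, thetaVec_antilinearStructure, thetaVec_antilinearStructure, Prod.smul_fst,
      mulVec_smul, hst, smul_comm]

/-- In the components `(dz, θ)` the map is off-diagonal. Its square is therefore block diagonal with
blocks `-Φ Dᵀ` and `-D Φᵀ`, and `D Φᵀ = 1` is exactly what is needed. -/
theorem antilinearStructure_sq [DecidableEq ι] (hD : D.IsHermitian) (hΦ : Φ.IsHermitian)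
    (hDΦ : D * Φᵀ = 1) {c : ℂ} (hc : conj c = c) (hc2 : c * c = 1) (X : Hol ι) :
    antilinearStructure D Φ A c (antilinearStructure D Φ A c X) = -X := by
  have hΦD : Φ * Dᵀ = 1 := by
    rw [← transpose_transpose Φ, ← transpose_mul, hDΦ, transpose_one]
  have hst (v : ι → ℂ) : star ((Complex.I * c) • v) = (-(Complex.I * c)) • star v := by
    rw [star_smul]; simp [hc]
  have hst' (v : ι → ℂ) : star ((-(Complex.I * c)) • v) = (Complex.I * c) • star v := by
    rw [star_smul]; simp [hc]
  have hcc : Complex.I * c * (Complex.I * c) = -1 := by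
    linear_combination c * c * Complex.I_mul_I - hc2
  refine ext_thetaVec (A := A) ?_ ?_
  · rw [antilinearStructure_fst, thetaVec_antilinearStructure, mulVec_smul, hst', smul_smul,
      star_transpose_mulVec, star_star, mulVec_mulVec, hΦ.eq, hΦD, one_mulVec, hcc]
    simp
  · rw [thetaVec_antilinearStructure, antilinearStructure_fst, mulVec_smul, hst, smul_smul,
      star_transpose_mulVec, star_star, mulVec_mulVec, hD.eq, hDΦ, one_mulVec, neg_mul_neg, hcc]
    simp [thetaVec, mulVec_neg]

/-- The holomorphic symplectic form against `antilinearStructure`. -/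
theorem symplectic_antilinearStructure (hA : A.IsSymm) (c : ℂ) (X Y : Hol ι) :
    (antilinearStructure D Φ A c X).2 ⬝ᵥ Y.1 - Y.2 ⬝ᵥ (antilinearStructure D Φ A c X).1 =
      -(Complex.I * c) * conj (hermForm D Φ A X Y) := by
  -- Symmetry of `A` means `dz^P A_{PI} ∧ dz^I = 0`, so `du` may be replaced by `θ`.
  have h1 (X Y : Hol ι) : X.2 ⬝ᵥ Y.1 - Y.2 ⬝ᵥ X.1 =
      thetaVec A X ⬝ᵥ Y.1 - thetaVec A Y ⬝ᵥ X.1 := by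
    rw [thetaVec, thetaVec, add_dotProduct, add_dotProduct, transpose_mulVec_dotProduct, hA.eq,
      dotProduct_comm (A *ᵥ Y.1)]
    ring
  rw [h1, thetaVec_antilinearStructure, antilinearStructure_fst, hermForm, map_add,
    ← transpose_mulVec_dotProduct, ← transpose_mulVec_dotProduct, conj_dotProduct, conj_dotProduct,
    star_star, star_star, smul_dotProduct, dotProduct_smul, dotProduct_comm (thetaVec A Y),
    smul_eq_mul, smul_eq_mul]
  ring

omit [Fintype ι] in
/-- Two-forms `ω₁, ω₂, ω₃` on a tangent space for which `ω₁ + iω₂` is of type `(2,0)` and which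
are related by an antilinear almost complex structure form a hyperkähler triple. -/
theorem isHyperkahlerTriple_of_antilinear {ω₁ ω₂ ω₃ : Hol ι → Hol ι → ℝ}
    {J₂ : Hol ι →ₗ[ℝ] Hol ι}
    (hneg : ∀ X Y, ω₁ (-X) Y = -ω₁ X Y)
    (hanti₁ : ∀ X Y, ω₁ X Y = -ω₁ Y X) (hanti₂ : ∀ X Y, ω₂ X Y = -ω₂ Y X)
    (hanti₃ : ∀ X Y, ω₃ X Y = -ω₃ Y X)
    (h₁ : ∀ X Y, ω₁ (Complex.I • X) Y = -ω₂ X Y) (h₂ : ∀ X Y, ω₂ (Complex.I • X) Y = ω₁ X Y)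
    (hnd : ∀ X, (∀ Y, ω₁ X Y = 0) → X = 0)
    (h₃ : ∀ X Y, ω₃ X Y = ω₁ (J₂ X) Y) (hsq : ∀ X, J₂ (J₂ X) = -X)
    (hJ : ∀ X, J₂ (Complex.I • X) = -(Complex.I • J₂ X))
    {I₃ : Hol ι →ₗ[ℝ] Hol ι} (hI₃ : ∀ X, I₃ X = Complex.I • X) :
    IsHyperkahlerTriple ω₁ ω₂ ω₃ (J₂ ∘ₗ I₃) J₂ I₃ (fun X Y => -ω₃ X (Complex.I • Y)) := by
  have hII (X : Hol ι) : Complex.I • Complex.I • X = -X := by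
    rw [smul_smul, Complex.I_mul_I, neg_one_smul]
  have r₁ (X Y : Hol ι) : ω₂ X Y = ω₃ (J₂ (Complex.I • X)) Y := by
    rw [h₃, hsq, hneg, h₁, neg_neg]
  -- As `I₁ = J₂ ∘ I₃`, this is the relation `I₁ I₂ = I₃`.
  have m₁₂ (X : Hol ι) : J₂ (Complex.I • J₂ X) = Complex.I • X := by
    rw [hJ, hsq, smul_neg, neg_neg]
  refine ⟨hnd, fun X h => ?_, fun X h => ?_, ?_, h₃, ?_, ?_, ?_, ?_, ?_, ?_, ?_, ?_⟩
  · have := hnd (Complex.I • X) fun Y => by rw [h₁, h, neg_zero]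
    simpa using this
  · have := hnd (J₂ X) fun Y => by rw [← h₃, h]
    rw [← neg_eq_zero, ← hsq, this, map_zero]
  · intro X Y
    rw [LinearMap.comp_apply, hI₃, r₁]
  · intro X Y
    rw [hI₃, h₂]
  · refine LinearMap.ext fun X => ?_
    simp only [LinearMap.comp_apply, hI₃, LinearMap.neg_apply, LinearMap.id_apply]
    rw [m₁₂, hII]
  · refine LinearMap.ext fun X => ?_
    simp only [LinearMap.comp_apply, LinearMap.neg_apply, LinearMap.id_apply, hsq]
  · refine LinearMap.ext fun X => ?_
    simp only [LinearMap.comp_apply, hI₃, LinearMap.neg_apply, LinearMap.id_apply, hII]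
  · refine LinearMap.ext fun X => ?_
    simp only [LinearMap.comp_apply, hI₃, m₁₂]
  · intro X Y
    rw [LinearMap.comp_apply, hI₃, ← hanti₁, ← h₃, ← hanti₃]
  · intro X Y
    rw [← hanti₂, r₁, m₁₂, ← hanti₃]
  · intro X Y
    rw [hI₃]

end HermitianForm

/-! ### The Legendre transform as a Kähler potential. -/

section KahlerPotential

open Matrix

variable {ι B : Type*} [Fintype ι] [DecidableEq ι] {j : ℕ} {H : B → FunctionElement ι}
  {L : Coeff ι j → ℂ} {U : Set (Hol ι)} {x : Hol ι → Coeff ι j} {p : ι → ℤ → Hol ι → ℂ}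
  {q : Hol ι}

theorem IsGLTSolution.fderiv_leading_p (hsol : IsGLTSolution L U x p) (hU : U ∈ 𝓝 q) (I : ι) :
    fderiv ℝ (fun r => p I (1 - j) r) q = du I := by
  have : (fun r => p I (1 - j) r) =ᶠ[𝓝 q] du I := by
    filter_upwards [hU] with r hr using hsol.leading_p r hr I
  rw [this.fderiv_eq, (du I).fderiv]

theorem IsGLTSolution.fderiv_leading_x (hsol : IsGLTSolution L U x p) (hU : U ∈ 𝓝 q) (I : ι) :
    fderiv ℝ (fun r => coef (x r) I j) q = dz I := by
  have : (fun r => coef (x r) I j) =ᶠ[𝓝 q] dz I := by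
    filter_upwards [hU] with r hr using hsol.leading_x r hr I
  rw [this.fderiv_eq, (dz I).fderiv]

theorem IsGLTSolution.omegaPlus_eq (hsol : IsGLTSolution L U x p) (hU : U ∈ 𝓝 q) (X Y : Hol ι) :
    omegaPlus x p q X Y = ∑ I, wedge (du I) (dz I) X Y := by
  simp [omegaPlus, omegaN, hsol.fderiv_leading_p hU, hsol.fderiv_leading_x hU]

omit [DecidableEq ι] in
theorem sum_wedge_du_dz (X Y : Hol ι) :
    ∑ I, wedge (du I) (dz I) X Y = (X.2 ⬝ᵥ Y.1 - Y.2 ⬝ᵥ X.1) / 2 := by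
  simp only [dotProduct, ← Finset.sum_sub_distrib, Finset.sum_div]
  rfl

theorem IsGLTSolution.omegaZero_eq (hsol : IsGLTSolution L U x p) (hU : U ∈ 𝓝 q) (X Y : Hol ι) :
    omegaZero x p q X Y =
      (X.2 ⬝ᵥ (fun I => fderiv ℝ (fun r => coef (x r) I (j - 1)) q Y) -
        Y.2 ⬝ᵥ (fun I => fderiv ℝ (fun r => coef (x r) I (j - 1)) q X) +
        (fun I => fderiv ℝ (fun r => p I (-j) r) q X) ⬝ᵥ Y.1 -
        (fun I => fderiv ℝ (fun r => p I (-j) r) q Y) ⬝ᵥ X.1) / 2 := by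
  have e : (1 : ℤ) - j - 1 = -j := by ring
  simp only [omegaZero, omegaN, Finset.sum_range_succ, Finset.sum_range_zero, zero_add,
    Nat.cast_zero, Nat.cast_one, sub_zero, sub_self, e, hsol.fderiv_leading_p hU,
    hsol.fderiv_leading_x hU]
  simp only [dotProduct, ← Finset.sum_sub_distrib, ← Finset.sum_add_distrib, Finset.sum_div]
  refine Finset.sum_congr rfl fun I _ => ?_
  simp only [wedge, du, dz]
  simp
  ring

/-- The differential of the Legendre transform. -/
theorem IsGLTSolution.fderiv_kappa (hsol : IsGLTSolution L U x p) (hj : 1 ≤ j) (hU : U ∈ 𝓝 q)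
    (hx : DifferentiableAt ℝ x q) (hL : IsContourPotentialAt H L (x q)) (Y : Hol ι) :
    fderiv ℝ (kappa L x) q Y = ∑ I, (d1 L I j (x q) * Y.1 I +
      (-1) ^ j * d1 L I (-j) (x q) * conj (Y.1 I) +
      Complex.I * coef (x q) I (j - 1) * Y.2 I -
      Complex.I * conj (coef (x q) I (j - 1)) * conj (Y.2 I)) := by
  have hq : q ∈ U := mem_of_mem_nhds hU
  choose f hf hfX using fun I => hasFDerivAt_coef hx I (j - 1)
  have h1 : HasFDerivAt (fun r => L (x r))
      (((fderiv ℂ L (x q)).restrictScalars ℝ).comp (fderiv ℝ x q)) q :=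
    HasFDerivAt.comp q (hL.differentiableAt.hasFDerivAt.restrictScalars ℝ) hx.hasFDerivAt
  have h2 (I : ι) : HasFDerivAt (fun r : Hol ι => r.2 I * coef (x r) I (j - 1))
      (q.2 I • f I + coef (x q) I (j - 1) • du I) q := (du I).hasFDerivAt.mul (hf I)
  have hc (I : ι) : HasFDerivAt (fun r : Hol ι => conj (coef (x r) I (j - 1)))
      (conjForm (f I)) q :=
    Complex.conjCLE.toContinuousLinearMap.hasFDerivAt.comp q (hf I)
  have h3 (I : ι) : HasFDerivAt (fun r : Hol ι => conj (r.2 I) * conj (coef (x r) I (j - 1)))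
      (conj (q.2 I) • conjForm (f I) + conj (coef (x q) I (j - 1)) • conjForm (du I)) q :=
    (conjForm (du I)).hasFDerivAt.mul (hc I)
  have h4 : HasFDerivAt (kappa L x) _ q :=
    (h1.add ((HasFDerivAt.fun_sum (u := Finset.univ) fun I _ => h2 I).const_mul Complex.I)).sub
      ((HasFDerivAt.fun_sum (u := Finset.univ) fun I _ => h3 I).const_mul Complex.I)
  -- Extremality: the inner variation of `L` is the negative of the terms of `dκ` in which `x_{j-1}`
  -- and its conjugate are varied.
  have hin : ∑ a : ι × Inner j, coef (fderiv ℝ x q Y) a.1 a.2 * d1 L a.1 a.2 (x q) =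
      ∑ I, (-Complex.I * q.2 I * f I Y + Complex.I * conj (q.2 I) * conj (f I Y)) := by
    rw [Fintype.sum_prod_type]
    refine Finset.sum_congr rfl fun I _ => ?_
    have hb : coef (fderiv ℝ x q Y) I (1 - j) = (-1) ^ (1 - (j : ℤ)) * conj (f I Y) := by
      have := (hsol.isRealCoeff_fderiv hU hx Y).coef_neg I (j - 1)
      rw [neg_sub] at this
      rw [this, hfX, ← neg_one_zpow_neg, neg_sub]
    have h5 : ∀ m : Inner j, coef (fderiv ℝ x q Y) I m * d1 L I m (x q) =
        (if m = top hj then -Complex.I * q.2 I * f I Y else 0) +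
          if m = bot hj then Complex.I * conj (q.2 I) * conj (f I Y) else 0 := by
      intro m
      rw [hsol.d1_eq hq I m.2]
      simp only [Subtype.ext_iff, top, bot]
      by_cases hb1 : (m : ℤ) = 1 - j <;> by_cases hb2 : (m : ℤ) = j - 1
      -- Occurs only for `j = 1`, `m = 0`. The one real coefficient is read as `dx_{j-1}` in the
      -- first term and as its conjugate in the second.
      · have h6 : coef (fderiv ℝ x q Y) I m = f I Y := by rw [hb2, hfX]
        have h7 : coef (fderiv ℝ x q Y) I m = (-1) ^ (m : ℤ) * conj (f I Y) := by rw [hb1, hb]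
        rw [if_pos hb1, if_pos hb2, if_pos hb1, if_pos hb2, mul_add]
        nth_rewrite 1 [h6]
        rw [h7]
        linear_combination Complex.I * conj (q.2 I) * conj (f I Y) * neg_one_zpow_mul_self (m : ℤ)
      · rw [if_pos hb1, if_neg hb2, if_pos hb1, if_neg hb2, hb1, hb]
        linear_combination
          Complex.I * conj (q.2 I) * conj (f I Y) * neg_one_zpow_mul_self (1 - j : ℤ)
      · rw [if_neg hb1, if_pos hb2, if_neg hb1, if_pos hb2, hb2, hfX]
        ring
      · rw [if_neg hb1, if_neg hb2, if_neg hb1, if_neg hb2]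
        ring
    rw [Finset.sum_congr rfl fun m _ => h5 m, Finset.sum_add_distrib, Finset.sum_ite_eq',
      Finset.sum_ite_eq', if_pos (Finset.mem_univ _), if_pos (Finset.mem_univ _)]
  have h8 := map_coeff_eq_sum hj (fderiv ℂ L (x q)) (fderiv ℝ x q Y)
  simp only [(hsol.isRealCoeff_fderiv hU hx Y).coef_neg, hsol.coef_fderiv_top hU hx] at h8
  rw [h4.fderiv]
  change fderiv ℂ L (x q) (fderiv ℝ x q Y) + Complex.I * (∑ I, _ : Hol ι →L[ℝ] ℂ) Y -
    Complex.I * (∑ I, _ : Hol ι →L[ℝ] ℂ) Y = _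
  rw [h8, _root_.sum_apply, _root_.sum_apply]
  change ∑ K, Y.1 K * d1 L K j (x q) +
    ∑ a : ι × Inner j, coef (fderiv ℝ x q Y) a.1 a.2 * d1 L a.1 a.2 (x q) +
    ∑ K, (-1) ^ (j : ℤ) * conj (Y.1 K) * d1 L K (-j) (x q) +
    Complex.I * ∑ I, (q.2 I * f I Y + coef (x q) I (j - 1) * Y.2 I) -
    Complex.I * ∑ I, (conj (q.2 I) * conj (f I Y) + conj (coef (x q) I (j - 1)) * conj (Y.2 I)) = _
  rw [hin]
  simp only [Finset.mul_sum, ← Finset.sum_sub_distrib, ← Finset.sum_add_distrib]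
  refine Finset.sum_congr rfl fun I _ => ?_
  rw [zpow_natCast]
  ring

/-- Only the `dz̄` and `dū` terms of `dκ` survive, and the matching equation gives `(-1)^j
L_{x_{-j}} = conj L_{x_j} = i conj p_{-j}`. -/
theorem IsGLTSolution.dbar_kappa (hsol : IsGLTSolution L U x p) (hj : 1 ≤ j) (hU : U ∈ 𝓝 q)
    (hx : DifferentiableAt ℝ x q) (hL : IsContourPotentialAt H L (x q)) (Y : Hol ι) :
    dbar (kappa L x) q Y =
      Complex.I * conj (∑ I, (p I (-j) q * Y.1 I - coef (x q) I (j - 1) * Y.2 I)) := by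
  have hq : q ∈ U := mem_of_mem_nhds hU
  rw [dbar, hsol.fderiv_kappa hj hU hx hL, hsol.fderiv_kappa hj hU hx hL, map_sum,
    Finset.mul_sum, Finset.mul_sum, ← Finset.sum_add_distrib, Finset.sum_div]
  refine Finset.sum_congr rfl fun I _ => ?_
  have h1 := congrArg conj (hsol.conj_d1_neg hj hq I)
  rw [Complex.conj_conj, map_mul, map_pow, map_neg, map_one] at h1
  have h2 : (-1 : ℂ) ^ j * (-1) ^ j = 1 := by rw [← mul_pow]; simp
  rw [h1, hsol.p_neg_eq hj hq]
  simp only [Prod.smul_fst, Prod.smul_snd, Pi.smul_apply, smul_eq_mul, map_sub, map_mul,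
    Complex.conj_I]
  linear_combination (conj (d1 L I j (x q)) * conj (Y.1 I)) * (1 - Complex.I * Complex.I) / 2 * h2 +
    (d1 L I j (x q) * Y.1 I / 2 + conj (d1 L I j (x q)) * conj (Y.1 I) / 2 +
      Complex.I * coef (x q) I (j - 1) * Y.2 I / 2 +
      Complex.I * conj (coef (x q) I (j - 1)) * conj (Y.2 I) / 2) * Complex.I_mul_I

/-- The Legendre transform is a Kähler potential. -/
theorem IsGLTSolution.ddbar_kappa (hsol : IsGLTSolution L U x p) (hj : 1 ≤ j) (hU : U ∈ 𝓝 q)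
    (hx : ∀ᶠ r in 𝓝 q, DifferentiableAt ℝ x r)
    (hL : ∀ᶠ r in 𝓝 q, IsContourPotentialAt H L (x r)) (X Y : Hol ι) :
    -Complex.I * ddbar (kappa L x) q X Y = conj (omegaZero x p q X Y) := by
  have hp (I : ι) : HasFDerivAt (fun r => p I (-j) r) (fderiv ℝ (fun r => p I (-j) r) q) q := by
    have h2 : (fun r => p I (-j) r) =ᶠ[𝓝 q] fun r => Complex.I * d1 L I j (x r) := by
      filter_upwards [hU] with r hr using hsol.p_neg_eq hj hr I
    exact (((hasFDerivAt_d1 hL.self_of_nhds hx.self_of_nhds I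
      (self_mem_Icc j)).const_mul Complex.I).congr_of_eventuallyEq h2).differentiableAt.hasFDerivAt
  have hc (I : ι) : HasFDerivAt (fun r => coef (x r) I (j - 1))
      (fderiv ℝ (fun r => coef (x r) I (j - 1)) q) q := by
    obtain ⟨f, hf, -⟩ := hasFDerivAt_coef hx.self_of_nhds I (j - 1)
    exact hf.differentiableAt.hasFDerivAt
  have key (X Y : Hol ι) : fderiv ℝ (fun r => dbar (kappa L x) r Y) q X =
      Complex.I * conj (∑ I, (fderiv ℝ (fun r => p I (-j) r) q X * Y.1 I -
        fderiv ℝ (fun r => coef (x r) I (j - 1)) q X * Y.2 I)) := by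
    -- Since `∂̄κ` involves no derivatives of `x` or `p`, differentiability of `x` suffices to
    -- differentiate it once more.
    have h1 : (fun r => dbar (kappa L x) r Y) =ᶠ[𝓝 q] fun r =>
        Complex.I * conj (∑ I, (p I (-j) r * Y.1 I - coef (x r) I (j - 1) * Y.2 I)) := by
      filter_upwards [hx, hL, eventually_mem_nhds_iff.2 hU] with r h1 h2 h3
      exact hsol.dbar_kappa hj h3 h1 h2 Y
    have h2 : HasFDerivAt (fun r => ∑ I, (p I (-j) r * Y.1 I - coef (x r) I (j - 1) * Y.2 I))
        (∑ I, (Y.1 I • fderiv ℝ (fun r => p I (-j) r) q -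
          Y.2 I • fderiv ℝ (fun r => coef (x r) I (j - 1)) q)) q :=
      HasFDerivAt.fun_sum fun I _ => ((hp I).mul_const _).sub ((hc I).mul_const _)
    have h3 := (Complex.conjCLE.toContinuousLinearMap.hasFDerivAt.comp q h2).const_mul Complex.I
    rw [(h3.congr_of_eventuallyEq h1).fderiv]
    change Complex.I * conj ((∑ I, _ : Hol ι →L[ℝ] ℂ) X) = _
    rw [_root_.sum_apply]
    congr 2
    refine Finset.sum_congr rfl fun I _ => ?_
    rw [_root_.sub_apply, _root_.smul_apply, _root_.smul_apply, smul_eq_mul, smul_eq_mul]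
    ring
  rw [ddbar, key, key, hsol.omegaZero_eq hU, ← mul_sub, ← map_sub]
  rw [show ∀ z : ℂ, -Complex.I * (Complex.I * z / 2) = z / 2 from fun z => by
    linear_combination (-z / 2) * Complex.I_mul_I]
  rw [map_div₀, Complex.conj_ofNat]
  congr 2
  simp only [dotProduct, ← Finset.sum_sub_distrib, ← Finset.sum_add_distrib]
  refine Finset.sum_congr rfl fun I _ => ?_
  ring

end KahlerPotential

/-! ### Assembling `ω_3`, the triple and the metric. -/

section Main

open Matrix

variable {ι B : Type*} [Fintype ι] [DecidableEq ι] {j : ℕ} {H : B → FunctionElement ι}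
  {L : Coeff ι j → ℂ} {U : Set (Hol ι)} {x : Hol ι → Coeff ι j} {p : ι → ℤ → Hol ι → ℂ}
  {q : Hol ι}

/-- The form `ω_0` in the coframe `(dz, θ)`, and the algebraic properties of its coefficients. -/
theorem IsGLTSolution.omegaZero_eq_hermForm (hsol : IsGLTSolution L U x p) (hj : 1 ≤ j)
    (hU : U ∈ 𝓝 q) (hx : DifferentiableAt ℝ x q) (hL : IsContourPotentialAt H L (x q))
    (hreal : ∀ᶠ y in 𝓝 (x q), IsRealCoeff y → (L y).im = 0)
    (hHess : IsUnit (hessInner L (x q)).det) (hPhi : IsUnit (PhiUp hj L (x q)).det) :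
    (PhiUp hj L (x q)).IsHermitian ∧
    (∀ I J, conj (AMat hj L (x q) I J) = -Complex.I * ∑ P, ∑ a : ι × Inner j,
      PhiInv hj L (x q) J P * (hessInner L (x q))⁻¹ (P, top hj) a *
        d2 L a.1 (a.2 : ℤ) I (-(j : ℤ)) (x q)) ∧
    (AMat hj L (x q)).IsSymm ∧ (PhiDown hj L (x q)).IsHermitian ∧
    PhiDown hj L (x q) * (PhiUp hj L (x q))ᵀ = 1 ∧
    ∀ X Y, omegaZero x p q X Y = (-1) ^ (j - 1) * Complex.I *
      ((hermForm (PhiDown hj L (x q)) (PhiUp hj L (x q)) (AMat hj L (x q)) X Y -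
        hermForm (PhiDown hj L (x q)) (PhiUp hj L (x q)) (AMat hj L (x q)) Y X) / 2) := by
  have hR := hsol.real q (mem_of_mem_nhds hU)
  obtain ⟨h, hs, hd⟩ := hL.exists_hankel
  have hc : ∀ m ∈ Finset.Icc (-(j : ℤ)) j, ∀ n ∈ Finset.Icc (-(j : ℤ)) j, ∀ I J,
      conj (h (m + n) I J) = (-1) ^ (m + n) * h (-m + -n) I J := by
    intro m hm n hn I J
    rw [← hd m hm n hn, conj_d2 hL hR hreal I J hm hn,
      hd _ (neg_mem_Icc hm) _ (neg_mem_Icc hn)]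
  have hM : hessInner L (x q) = hankel j h := hessInner_eq_hankel hd
  have hΦM : PhiUp hj L (x q) =
      block (hankel j h)⁻¹ (top hj) (bot hj) := by
    rw [← hM]; rfl
  have hdet : IsUnit (hankel j h).det := hM ▸ hHess
  have hA : (AMat hj L (x q)).IsSymm := AMat_isSymm hj hs hd hdet (hΦM ▸ hPhi)
  have hΦ : (PhiUp hj L (x q)).IsHermitian := by
    rw [hΦM]; exact block_hankel_inv_isHermitian hj hs hc hdet
  have hAB := AMat_eq hj hd
  have hAH := conj_AMat_eq hj hs hd hc hdet
  have hS := transpose_block_mul_schur hj hs hdet (hΦM ▸ hPhi)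
  rw [← hΦM] at hAB hAH hS
  -- The inverse of `Φ` is Hermitian, so its conjugate is its transpose.
  have hDinv : PhiDown hj L (x q) = ((PhiUp hj L (x q))⁻¹)ᵀ := by
    ext I J
    exact congrFun (congrFun hΦ.inv.eq J) I
  have hDH : (PhiDown hj L (x q)).IsHermitian := by
    rw [hDinv]; exact hΦ.inv.transpose
  have hDΦ : PhiDown hj L (x q) * (PhiUp hj L (x q))ᵀ = 1 := by
    rw [hDinv, ← Matrix.transpose_mul, Matrix.mul_nonsing_inv _ hPhi, Matrix.transpose_one]
  have hconjA (I J : ι) : conj (AMat hj L (x q) I J) = -Complex.I * ∑ P, ∑ a : ι × Inner j,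
      PhiInv hj L (x q) J P * (hessInner L (x q))⁻¹ (P, top hj) a *
        d2 L a.1 (a.2 : ℤ) I (-(j : ℤ)) (x q) := by
    have h1 := congrFun (congrFun hAH J) I
    rw [conjTranspose_apply, Matrix.smul_apply, smul_eq_mul, mul_apply] at h1
    refine h1.trans ?_
    congr 1
    refine Finset.sum_congr rfl fun P _ => ?_
    rw [mul_apply, Finset.mul_sum]
    refine Finset.sum_congr rfl fun a _ => ?_
    rw [hd _ (coe_inner_mem _) _ (neg_mem_Icc (self_mem_Icc j)), hM, mul_assoc]
    have h2 : (hankel j h)⁻¹ a (P, top hj) = (hankel j h)⁻¹ (P, top hj) a :=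
      congrFun (congrFun (hankel_inv_isSymm hs).eq _) _
    have h3 : h (a.2 + -j) a.1 I = hankelRow j h (-j) I a := by
      rw [add_comm, hs]; rfl
    rw [← h2, h3]
    rfl
  have hdx := hsol.fderiv_x_top hj hU hx hL hs hd hdet
  have hdp := hsol.fderiv_p hj hU hx hL hs hd hdet
  have hT : (block (hankel j h)⁻¹ (top hj) (top hj)).IsSymm :=
    (hankel_inv_isSymm hs).submatrix _
  have hK : (Matrix.of (h (j + j)) - hankelRow j h j * (hankel j h)⁻¹ *
      (hankelRow j h j)ᵀ).IsSymm := by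
    rw [Matrix.IsSymm, Matrix.transpose_sub, Matrix.transpose_mul, Matrix.transpose_mul,
      Matrix.transpose_transpose, (hankel_inv_isSymm hs).eq, Matrix.mul_assoc]
    congr 1
    ext I J
    exact hs _ _ _
  set Φ := PhiUp hj L (x q)
  set A := AMat hj L (x q)
  set D := PhiDown hj L (x q)
  set N := (hankel j h)⁻¹ with hN
  have hB : hankelRow j h j * blockCol N (bot hj) = Complex.I • (A * Φ) := by
    rw [hAB, Matrix.smul_mul, Matrix.mul_assoc, Matrix.nonsing_inv_mul _ hPhi, Matrix.mul_one,
      smul_smul]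
    simp
  have hY : (blockCol N (top hj))ᵀ * (hankelRow j h (-j))ᵀ = Complex.I • (Φ * Aᴴ) := by
    rw [hAH, Matrix.mul_smul, ← Matrix.mul_assoc, Matrix.mul_nonsing_inv _ hPhi, Matrix.one_mul,
      smul_smul]
    simp
  -- The Monge–Ampère identity solved for the `dz ∧ dz̄` coefficient; `Φᵀ` is cancelled by its
  -- inverse `D`, and `i · i` accounts for the sign of `A Φ Aᴴ`.
  have hDS : Matrix.of (h 0) - hankelRow j h j * N * (hankelRow j h (-j))ᵀ =
      D + A * Φ * Aᴴ := by
    have h1 := congrArg (D * ·) hS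
    simp only [← Matrix.mul_assoc D, hDΦ, Matrix.one_mul, Matrix.mul_one] at h1
    rw [← h1, hY, hB, Matrix.smul_mul, Matrix.mul_assoc A, Matrix.mul_nonsing_inv _ hPhi,
      Matrix.mul_one, Matrix.smul_mul, Matrix.mul_smul, smul_smul, Complex.I_mul_I,
      Matrix.mul_assoc A]
    simp
  refine ⟨hΦ, hconjA, hA, hDH, hDΦ, fun X Y => ?_⟩
  rw [hsol.omegaZero_eq hU, pairing_eq_hermForm (A := A) (Φ := Φ) (D := D)
    (E := hankelRow j h j * blockCol N (top hj)) hT hK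
    ((-1) ^ (j - 1)) (dx := fun X I => fderiv ℝ (fun r => coef (x r) I (j - 1)) q X)
    (dp := fun X I => fderiv ℝ (fun r => p I (-j) r) q X) ?_ ?_ X Y]
  · ring
  · intro X
    rw [hdx X, hY, ← hΦM, Matrix.smul_mulVec, smul_smul, mul_comm Complex.I]
  · intro X
    rw [hdp X, hB, hDS, Matrix.smul_mulVec, smul_smul, mul_comm Complex.I]

theorem IsGLTSolution.exists_isHyperkahlerTriple (hsol : IsGLTSolution L U x p) (hj : 1 ≤ j)
    (hU : U ∈ 𝓝 q) {D Φ A : Matrix ι ι ℂ} (hΦ : Φ.IsHermitian) (hA : A.IsSymm)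
    (hDH : D.IsHermitian) (hDΦ : D * Φᵀ = 1)
    (hω : ∀ X Y, omegaZero x p q X Y = (-1) ^ (j - 1) * Complex.I *
      ((hermForm D Φ A X Y - hermForm D Φ A Y X) / 2)) :
    (∀ X Y, conj (omegaZero x p q X Y) = omegaZero x p q X Y) ∧
    ∃ (I₁ I₂ I₃ : Hol ι →ₗ[ℝ] Hol ι) (g : Hol ι → Hol ι → ℝ),
      IsHyperkahlerTriple (omega1 x p q) (omega2 x p q) (omega3 x p q) I₁ I₂ I₃ g ∧
      (∀ X, I₃ X = Complex.I • X) ∧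
      ∀ X Y, (g X Y : ℂ) = (-1) ^ j * ((hermForm D Φ A X Y + hermForm D Φ A Y X) / 2) := by
  have hcr : conj ((-1 : ℂ) ^ (j - 1)) = (-1) ^ (j - 1) := by simp
  have hcc : (-1 : ℂ) ^ (j - 1) * (-1) ^ (j - 1) = 1 := by rw [← mul_pow]; simp
  have hconj := conj_hermForm (A := A) hDH hΦ
  have hωreal (X Y : Hol ι) : conj (omegaZero x p q X Y) = omegaZero x p q X Y := by
    rw [hω]
    simp only [map_mul, map_div₀, map_sub, hconj, hcr, Complex.conj_I, Complex.conj_ofNat]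
    ring
  have hω₃ (X Y : Hol ι) : (omega3 x p q X Y : ℂ) = omegaZero x p q X Y :=
    Complex.conj_eq_iff_re.1 (hωreal X Y)
  have hplus (X Y : Hol ι) : 2 * omegaPlus x p q X Y = X.2 ⬝ᵥ Y.1 - Y.2 ⬝ᵥ X.1 := by
    rw [hsol.omegaPlus_eq hU, sum_wedge_du_dz]; ring
  have hω₁ (X Y : Hol ι) : omega1 x p q X Y = (X.2 ⬝ᵥ Y.1 - Y.2 ⬝ᵥ X.1).re := by
    rw [← hplus]; simp [omega1]
  have hω₂ (X Y : Hol ι) : omega2 x p q X Y = (X.2 ⬝ᵥ Y.1 - Y.2 ⬝ᵥ X.1).im := by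
    rw [← hplus]; simp [omega2]
  have hI (X Y : Hol ι) : (Complex.I • X).2 ⬝ᵥ Y.1 - Y.2 ⬝ᵥ (Complex.I • X).1 =
      Complex.I * (X.2 ⬝ᵥ Y.1 - Y.2 ⬝ᵥ X.1) := by
    rw [Prod.smul_fst, Prod.smul_snd, smul_dotProduct, dotProduct_smul, smul_eq_mul, smul_eq_mul,
      mul_sub]
  refine ⟨hωreal, _, antilinearStructure D Φ A ((-1) ^ (j - 1)),
    (LinearMap.lsmul ℂ (Hol ι) Complex.I).restrictScalars ℝ, _,
    isHyperkahlerTriple_of_antilinear ?_ ?_ ?_ ?_ ?_ ?_ ?_ ?_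
      (antilinearStructure_sq hDH hΦ hDΦ hcr hcc) (antilinearStructure_I_smul D Φ A _)
      fun X => rfl, fun X => rfl, fun X Y => ?_⟩
  · intro X Y
    rw [hω₁, hω₁, ← Complex.neg_re, Prod.fst_neg, Prod.snd_neg, neg_dotProduct, dotProduct_neg,
      neg_sub_neg, neg_sub]
  · intro X Y
    rw [hω₁, hω₁, ← Complex.neg_re, neg_sub]
  · intro X Y
    rw [hω₂, hω₂, ← Complex.neg_im, neg_sub]
  · intro X Y
    rw [← Complex.ofReal_inj, Complex.ofReal_neg, hω₃, hω₃, hω, hω]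
    ring
  · intro X Y
    rw [hω₁, hω₂, hI, Complex.I_mul_re]
  · intro X Y
    rw [hω₁, hω₂, hI, Complex.I_mul_im]
  · intro X hX
    -- Against this vector `ω_1` returns the squared norm of `X`.
    have h1 := hX (star X.2, -star X.1)
    rw [hω₁, neg_dotProduct, sub_neg_eq_add, dotProduct_comm (star X.1)] at h1
    have h2 (v : ι → ℂ) : (v ⬝ᵥ star v).re = ∑ i, Complex.normSq (v i) := by
      simp [dotProduct, Complex.normSq_apply]
    rw [Complex.add_re, h2, h2] at h1
    have h3 (v : ι → ℂ) : 0 ≤ ∑ i, Complex.normSq (v i) :=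
      Finset.sum_nonneg fun i _ => Complex.normSq_nonneg _
    have h4 (v : ι → ℂ) (hv : ∑ i, Complex.normSq (v i) = 0) : v = 0 := by
      ext i
      exact Complex.normSq_eq_zero.1
        ((Finset.sum_eq_zero_iff_of_nonneg fun i _ => Complex.normSq_nonneg _).1 hv i
          (Finset.mem_univ i))
    exact Prod.ext (h4 _ (by linarith [h3 X.1, h3 X.2])) (h4 _ (by linarith [h3 X.1, h3 X.2]))
  · intro X Y
    rw [hω₁, symplectic_antilinearStructure hA]
    have h1 := hω₃ X Y
    rw [hω, ← hconj X Y] at h1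
    rw [← Complex.ofReal_re (omega3 x p q X Y), h1]
    have h2 : ((-1 : ℂ) ^ (j - 1)).im = 0 := Complex.conj_eq_iff_im.1 hcr
    simp [h2]
  -- Antilinearity in the second argument turns the difference in `ω_3` into the sum in `g`; the
  -- sign is `-(-1)^{j-1} = (-1)^j`.
  · rw [Complex.ofReal_neg, hω₃, hω, hermForm_I_smul, ← hconj X (Complex.I • Y), hermForm_I_smul,
      ← hconj X Y, neg_one_pow_eq_neg hj]
    simp only [map_mul, map_neg, Complex.conj_I, neg_neg]
    linear_combination (-1) ^ (j - 1) * (hermForm D Φ A X Y + conj (hermForm D Φ A X Y)) / 2 *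
      Complex.I_mul_I

end Main

end GLT

theorem mainTheorem1 {ι B : Type*} [Fintype ι] [DecidableEq ι]
    (j : ℕ) (hj : 1 ≤ j)
    (H : B → GLT.FunctionElement ι)
    (L : GLT.Coeff ι j → ℂ)
    (U : Set (GLT.Hol ι)) (hU : IsOpen U)
    (x : GLT.Hol ι → GLT.Coeff ι j) (p : ι → ℤ → GLT.Hol ι → ℂ)
    (hx : DifferentiableOn ℝ x U)
    (hL : ∀ q ∈ U, GLT.IsContourPotentialAt H L (x q))
    (hreal : ∀ q ∈ U, ∀ᶠ y in 𝓝 (x q), GLT.IsRealCoeff y → (L y).im = 0)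
    (hsol : GLT.IsGLTSolution L U x p)
    (q : GLT.Hol ι) (hq : q ∈ U)
    (hHess : IsUnit (GLT.hessInner L (x q)).det)
    (hPhi : IsUnit (GLT.PhiUp hj L (x q)).det) :
    -- the matrix Φ is Hermitian, and the formula for the complex conjugate of A
    (GLT.PhiUp hj L (x q)).IsHermitian ∧
    (∀ I J, conj (GLT.AMat hj L (x q) I J) =
      -Complex.I * ∑ P, ∑ a : ι × GLT.Inner j,
        GLT.PhiInv hj L (x q) J P * (GLT.hessInner L (x q))⁻¹ (P, GLT.top hj) a *
          GLT.d2 L a.1 (a.2 : ℤ) I (-(j : ℤ)) (x q)) ∧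
    -- the form ω_+
    (∀ X Y, GLT.omegaPlus x p q X Y = ∑ I, GLT.wedge (GLT.du I) (GLT.dz I) X Y) ∧
    -- the form ω_3, which is real and has the Kähler potential κ
    (∀ X Y, GLT.omegaZero x p q X Y =
      (-1) ^ (j - 1) * Complex.I *
        ((∑ I, ∑ J, GLT.PhiDown hj L (x q) I J *
            GLT.wedge (GLT.dz I) (GLT.conjForm (GLT.dz J)) X Y) +
          ∑ I, ∑ J, GLT.PhiUp hj L (x q) I J *
            GLT.wedge (GLT.theta (GLT.AMat hj L (x q)) I)
              (GLT.conjForm (GLT.theta (GLT.AMat hj L (x q)) J)) X Y)) ∧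
    (∀ X Y, (GLT.omegaZero x p q X Y).im = 0) ∧
    (∀ X Y, GLT.omegaZero x p q X Y = -Complex.I * GLT.ddbar (GLT.kappa L x) q X Y) ∧
    -- the hyperkähler metric
    ∃ (I₁ I₂ I₃ : GLT.Hol ι →ₗ[ℝ] GLT.Hol ι) (g : GLT.Hol ι → GLT.Hol ι → ℝ),
      GLT.IsHyperkahlerTriple (GLT.omega1 x p q) (GLT.omega2 x p q) (GLT.omega3 x p q)
        I₁ I₂ I₃ g ∧
      (∀ X, I₃ X = Complex.I • X) ∧
      ∀ X Y, (g X Y : ℂ) =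
        (-1) ^ j *
          ((∑ I, ∑ J, GLT.PhiDown hj L (x q) I J *
              GLT.symProd (GLT.dz I) (GLT.conjForm (GLT.dz J)) X Y) +
            ∑ I, ∑ J, GLT.PhiUp hj L (x q) I J *
              GLT.symProd (GLT.theta (GLT.AMat hj L (x q)) I)
                (GLT.conjForm (GLT.theta (GLT.AMat hj L (x q)) J)) X Y) := by
  have hU' : U ∈ 𝓝 q := hU.mem_nhds hq
  obtain ⟨hΦ, hconjA, hA, hD, hDΦ, hω⟩ := hsol.omegaZero_eq_hermForm hj hU'
    ((hx q hq).differentiableAt hU') (hL q hq) (hreal q hq) hHess hPhi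
  obtain ⟨hωreal, I₁, I₂, I₃, g, hT, hI₃, hg⟩ :=
    hsol.exists_isHyperkahlerTriple hj hU' hΦ hA hD hDΦ hω
  refine ⟨hΦ, hconjA, hsol.omegaPlus_eq hU', fun X Y => ?_,
    fun X Y => Complex.conj_eq_iff_im.1 (hωreal X Y), fun X Y => ?_, I₁, I₂, I₃, g, hT, hI₃,
    fun X Y => ?_⟩
  · rw [GLT.sum_wedge, hω]
  · rw [hsol.ddbar_kappa (H := H) hj hU', hωreal]
    · filter_upwards [hU.eventually_mem hq] with r hr
      exact (hx r hr).differentiableAt (hU.mem_nhds hr)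
    · filter_upwards [hU.eventually_mem hq] with r hr using hL r hr
  · rw [GLT.sum_symProd, hg]
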